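/- Conventions. For a semigroup $S$, $x,y\in S$ and $w_1,w_2,\ldots\in S^1$ put $\lambda_0=x$, $\rho_0=y$, $\lambda_{n+1}=\lambda_n w_{n+1}\rho_n$, $\rho_{n+1}=\rho_n w_{n+1}\lambda_n$. $S$ is nilpotent (in the sense of Mal'cev) if for some $n\ge 1$ one has $\lambda_n=\rho_n$ for all $x,y\in S$, $w_1,\ldots,w_n\in S^1$. The upper non-nilpotent graph $\mathcal N_S$ has vertex set $S$, with $x,y$ adjacent if $\langle x,y\rangle$ is not nilpotent. The empty set counts as an ideal, and $S/\emptyset=S$. $S$ is pseudo-nilpotent if, whenever $x,y\in S$, $w_1,\ldots,w_m\in S^1$, $0\le t<m$, $\lambda_t\ne\rho_t$, $(\lambda_t,\rho_t)=(\lambda_m,\rho_m)$, and $I$ is an ideal (possibly empty) of $T=\langle x,y,w_1,\ldots,w_m\rangle$ with $\lambda_m,\rho_m\notin I$, then $\lambda_i$ and $\rho_i$ are adjacent in $\mathcal N_{T/I}$ for every $0\le i\le m$. Let $S=S_1\supset S_2\supset\cdots\supset S_m\supset S_{m+1}=\emptyset$ be a principal series of a finite semigroup $S$ (the $S_i$ are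 ideals of $S$, with no ideal of $S$ strictly between $S_i$ and $S_{i+1}$). Let $F_i$ be the set of all $s\in S\setminus S_i$ such that $sj\notin S_{i+1}$ or $js\notin S_{i+1}$ for some $j\in S_i\setminus S_{i+1}$. The set $S_i\setminus S_{i+1}$ is a root if $S_i/S_{i+1}$ is not nilpotent and no element of $S_i\setminus S_{i+1}$ is adjacent in $\mathcal N_S$ to an element of $S_{i+1}$; its stem is then $S^{(i)}=\bigcup\{S_j\setminus S_{j+1} : j\le i,\ S_j\setminus S_{j+1}\subseteq F_i\cup(S_i\setminus S_{i+1})\}$. The set $S_i\setminus S_{i+1}$ is an isolated subset if it is not a root and $S_j/S_{j+1}$ is nilpotent for every $j$ with $S_i\setminus S_{i+1}\subseteq F_j$. Let $K$ be the union of all isolated subsets. Statement. Let $S$ be a pseudo-nilpotent finite semigroup with a principal series as above. Then: 1. Every connected component of $\mathcal N_S$ with more than one element is a union of stems. 2. For every connected component $C$ of $\mathcal N_S$, the set $C\cup K$ is a subsemigroup of $S$. 3. $K$ is the largest nilpotent ideal of $S$ (possibly empty). Let $C_1,\ldots,C_n$ be the connected components of $\mathcal N_S$ with more than one element; they are disjoint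 from $K$. Let $\theta$ be the zero of $S/K$ (to be omitted throughout if $K=\emptyset$, when $S/K=S$), identify the elements of $S\setminus K$ with their images in $S/K$, and put $C_i^\theta=C_i\cup\{\theta\}$. Then every $C_i^\theta$ is a subsemigroup of $S/K$, $S/K=\{\theta\}\cup C_1^\theta\cup\cdots\cup C_n^\theta$, and for $i\neq j$ one has $C_i^\theta\cap C_j^\theta=\{\theta\}$ and $C_i^\theta C_j^\theta\subseteq\{\theta\}$. That is, $S/K=C_1^\theta\cup\cdots\cup C_n^\theta$ is a $0$-disjoint union. -/

import Mathlib

section Basic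

variable {S : Type*} [Semigroup S]

/-- The product `a w b` in `S`, where `w` ranges over `S` with an identity `1` adjoined. -/
def sandwich (a : S) (w : WithOne S) (b : S) : S :=
  WithOne.recOneCoe (motive := fun _ => S) (a * b) (fun s => a * s * b) w

/-- The pair `(λ_n, ρ_n)`, where `λ_0 = x`, `ρ_0 = y`, `λ_{n+1} = λ_n w_n ρ_n` and
`ρ_{n+1} = ρ_n w_n λ_n`; the parameters are numbered `w 0, w 1, …`, so that `(λ_n, ρ_n)` depends
on `w 0, …, w (n - 1)` only. -/
def malcevPair (x y : S) (w : ℕ → WithOne S) : ℕ → S × S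
  | 0 => (x, y)
  | n + 1 =>
    (sandwich (malcevPair x y w n).1 (w n) (malcevPair x y w n).2,
      sandwich (malcevPair x y w n).2 (w n) (malcevPair x y w n).1)

/-- `λ_n(x, y, w 0, …, w (n - 1))`. -/
def malcevLam (x y : S) (w : ℕ → WithOne S) (n : ℕ) : S := (malcevPair x y w n).1

/-- `ρ_n(x, y, w 0, …, w (n - 1))`. -/
def malcevRho (x y : S) (w : ℕ → WithOne S) (n : ℕ) : S := (malcevPair x y w n).2

/-- The subsemigroup `⟨x, y, w 0, …, w (m - 1)⟩` of `S` (parameters equal to the adjoined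
identity contribute no generator). -/
def malcevGen (x y : S) (w : ℕ → WithOne S) (m : ℕ) : Subsemigroup S :=
  Subsemigroup.closure ({x, y} ∪ {s : S | ∃ k < m, w k = (s : WithOne S)})

theorem sandwich_mem (T : Subsemigroup S) {a b : S} (ha : a ∈ T) (hb : b ∈ T)
    (w : WithOne S) (hw : ∀ s : S, w = (s : WithOne S) → s ∈ T) : sandwich a w b ∈ T := by
  induction w using WithOne.recOneCoe with
  | one => exact T.mul_mem ha hb
  | coe s => exact T.mul_mem (T.mul_mem ha (hw s rfl)) hb

theorem malcevPair_mem (x y : S) (w : ℕ → WithOne S) (m : ℕ) :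
    ∀ i, i ≤ m → malcevLam x y w i ∈ malcevGen x y w m ∧ malcevRho x y w i ∈ malcevGen x y w m
  | 0, _ => ⟨Subsemigroup.subset_closure (by simp [malcevLam, malcevPair]),
      Subsemigroup.subset_closure (by simp [malcevRho, malcevPair])⟩
  | i + 1, hi => by
    obtain ⟨h1, h2⟩ := malcevPair_mem x y w m i (by omega)
    have hw : ∀ s : S, w i = (s : WithOne S) → s ∈ malcevGen x y w m := fun s hs =>
      Subsemigroup.subset_closure (Or.inr ⟨i, by omega, hs⟩)
    exact ⟨sandwich_mem _ h1 h2 _ hw, sandwich_mem _ h2 h1 _ hw⟩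

/-- `λ_i`, for `i ≤ m`, as an element of `⟨x, y, w 0, …, w (m - 1)⟩`. -/
def malcevLamGen (x y : S) (w : ℕ → WithOne S) (m i : ℕ) (hi : i ≤ m) : malcevGen x y w m :=
  ⟨malcevLam x y w i, (malcevPair_mem x y w m i hi).1⟩

/-- `ρ_i`, for `i ≤ m`, as an element of `⟨x, y, w 0, …, w (m - 1)⟩`. -/
def malcevRhoGen (x y : S) (w : ℕ → WithOne S) (m i : ℕ) (hi : i ≤ m) : malcevGen x y w m :=
  ⟨malcevRho x y w i, (malcevPair_mem x y w m i hi).2⟩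

end Basic

/-- Nilpotency of a semigroup in the sense of Mal'cev. -/
def IsMalcevNilpotent (S : Type*) [Semigroup S] : Prop :=
  ∃ n : ℕ, 0 < n ∧ ∀ (a b : S) (c : ℕ → WithOne S), malcevLam a b c n = malcevRho a b c n

/-- The upper non-nilpotent graph of a semigroup: distinct elements `x`, `y` are adjacent if the
subsemigroup `⟨x, y⟩` is not nilpotent. -/
def upperNonNilpotentGraph (S : Type*) [Semigroup S] : SimpleGraph S where
  Adj x y := x ≠ y ∧ ¬ IsMalcevNilpotent (Subsemigroup.closure ({x, y} : Set S))
  symm := ⟨fun x y h => ⟨h.1.symm, by rw [Set.pair_comm]; exact h.2⟩⟩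
  loopless := ⟨fun _ h => h.1 rfl⟩

section Ideals

variable {S : Type*} [Semigroup S]

/-- Two-sided ideals of a semigroup; the empty set is regarded as an ideal. -/
def IsSemigroupIdeal (I : Set S) : Prop :=
  ∀ a ∈ I, ∀ s : S, s * a ∈ I ∧ a * s ∈ I

/-- An ideal as a subsemigroup. -/
def IsSemigroupIdeal.toSubsemigroup {I : Set S} (hI : IsSemigroupIdeal I) : Subsemigroup S where
  carrier := I
  mul_mem' := fun {a} {b} _ hb => (hI b hb a).1

/-- The Rees congruence of an ideal: `I` is collapsed to a point, and nothing else is. -/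
def reesCon (I : Set S) (hI : IsSemigroupIdeal I) : Con S where
  r a b := a = b ∨ (a ∈ I ∧ b ∈ I)
  iseqv :=
    ⟨fun _ => Or.inl rfl,
      fun h => h.elim (fun h => Or.inl h.symm) (fun h => Or.inr ⟨h.2, h.1⟩),
      by
        rintro a b c (rfl | ⟨ha, hb⟩) (rfl | ⟨hb', hc⟩)
        · exact Or.inl rfl
        · exact Or.inr ⟨hb', hc⟩
        · exact Or.inr ⟨ha, hb⟩
        · exact Or.inr ⟨ha, hc⟩⟩
  mul' := by
    rintro a b c d (rfl | ⟨ha, hb⟩) (rfl | ⟨hc, hd⟩)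
    · exact Or.inl rfl
    · exact Or.inr ⟨(hI _ hc _).1, (hI _ hd _).1⟩
    · exact Or.inr ⟨(hI _ ha _).2, (hI _ hb _).2⟩
    · exact Or.inr ⟨(hI _ ha _).2, (hI _ hb _).2⟩

/-- The Rees factor semigroup `S / I`; in particular `S / ∅` is `S`. -/
abbrev ReesQuotient (I : Set S) (hI : IsSemigroupIdeal I) : Type _ := (reesCon I hI).Quotient

/-- The canonical map `S → S / I`. -/
def ReesQuotient.mk (I : Set S) (hI : IsSemigroupIdeal I) (s : S) : ReesQuotient I hI :=
  ((s : S) : (reesCon I hI).Quotient)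

/-- The trace of an ideal on a subsemigroup is an ideal of the subsemigroup. -/
theorem IsSemigroupIdeal.preimage {I : Set S} (hI : IsSemigroupIdeal I) (T : Subsemigroup S) :
    IsSemigroupIdeal ((fun t : T => (t : S)) ⁻¹' I) :=
  fun a ha s => hI a ha s

end Ideals

/-- Pseudo-nilpotent semigroups. -/
def IsPseudoNilpotent (S : Type*) [Semigroup S] : Prop :=
  ∀ (t m : ℕ) (x y : S) (w : ℕ → WithOne S), t < m →
    malcevLam x y w t ≠ malcevRho x y w t →
    malcevLam x y w t = malcevLam x y w m →
    malcevRho x y w t = malcevRho x y w m →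
    ∀ (I : Set (malcevGen x y w m)) (hI : IsSemigroupIdeal I),
      malcevLamGen x y w m m le_rfl ∉ I → malcevRhoGen x y w m m le_rfl ∉ I →
      ∀ (i : ℕ) (hi : i ≤ m),
        (upperNonNilpotentGraph (ReesQuotient I hI)).Adj
          (ReesQuotient.mk I hI (malcevLamGen x y w m i hi))
          (ReesQuotient.mk I hI (malcevRhoGen x y w m i hi))

/-- A principal series `S = S_0 ⊃ S_1 ⊃ ⋯ ⊃ S_m = ∅` of a semigroup: a chain of ideals such that
no ideal lies strictly between consecutive terms (here numbered from `0`). -/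
structure PrincipalSeries (S : Type*) [Semigroup S] where
  length : ℕ
  ideal : Fin (length + 1) → Set S
  isIdeal : ∀ i, IsSemigroupIdeal (ideal i)
  first : ideal 0 = Set.univ
  last : ideal (Fin.last length) = ∅
  ssubset : ∀ i : Fin length, ideal i.succ ⊂ ideal i.castSucc
  maximal : ∀ (i : Fin length) (I : Set S), IsSemigroupIdeal I →
    ¬ (ideal i.succ ⊂ I ∧ I ⊂ ideal i.castSucc)

namespace PrincipalSeries

variable {S : Type*} [Semigroup S] (P : PrincipalSeries S)

/-- The set `S_i \ S_{i+1}`. -/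
def layer (i : Fin P.length) : Set S := P.ideal i.castSucc \ P.ideal i.succ

/-- The principal factor `S_i / S_{i+1}`. -/
abbrev Factor (i : Fin P.length) : Type _ :=
  ReesQuotient _ ((P.isIdeal i.succ).preimage (P.isIdeal i.castSucc).toSubsemigroup)

/-- The set `F_J(S / S_{i+1})` for the ideal `J = S_i / S_{i+1}` of `S / S_{i+1}`, where non-zero
elements of `S / S_{i+1}` are identified with elements of `S \ S_{i+1}` (a zero being adjoined if
`S_{i+1}` is empty): the elements `s` outside `J` with `s j ≠ θ` or `j s ≠ θ` for some `j ∈ J`. -/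
def F (i : Fin P.length) : Set S :=
  {s | s ∉ P.ideal i.castSucc ∧
    ∃ j ∈ P.layer i, s * j ∉ P.ideal i.succ ∨ j * s ∉ P.ideal i.succ}

/-- `S_i \ S_{i+1}` is a root. -/
def IsRoot (i : Fin P.length) : Prop :=
  ¬ IsMalcevNilpotent (P.Factor i) ∧
    ∀ a ∈ P.layer i, ∀ b ∈ P.ideal i.succ, ¬ (upperNonNilpotentGraph S).Adj a b

/-- The set `S^{(i)}`: the union of the `S_j \ S_{j+1}` with `j ≤ i` that are contained in
`F_J(S / S_{i+1}) ∪ (S_i \ S_{i+1})`, `J = S_i / S_{i+1}`. If `S_i \ S_{i+1}` is a root, this is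
its stem. -/
def stem (i : Fin P.length) : Set S :=
  {s | ∃ j : Fin P.length, j ≤ i ∧ P.layer j ⊆ P.F i ∪ P.layer i ∧ s ∈ P.layer j}

/-- `S_i \ S_{i+1}` is an isolated subset. -/
def IsIsolated (i : Fin P.length) : Prop :=
  ¬ P.IsRoot i ∧ ∀ j : Fin P.length, P.layer i ⊆ P.F j → IsMalcevNilpotent (P.Factor j)

/-- The union `K` of all isolated subsets. -/
def K : Set S := {s | ∃ i : Fin P.length, P.IsIsolated i ∧ s ∈ P.layer i}

end PrincipalSeries

/-- The image of `C ∪ K` in the Rees factor semigroup `S / K`: for `C` disjoint from `K`, this is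
`C^θ`, i.e. `C` together with the zero `θ` of `S / K` (there is no `θ` if `K` is empty). -/
def adjoinTheta {S : Type*} [Semigroup S] (K : Set S) (hK : IsSemigroupIdeal K) (C : Set S) :
    Set (ReesQuotient K hK) :=
  ReesQuotient.mk K hK '' (C ∪ K)

/-!
Everything takes place relative to the `𝓙`-order of `S`, computed in the monoid `WithOne S`.

If a Mal'cev sequence does not collapse, it runs into a cycle by finiteness, and pseudo-nilpotency,
applied to the ideal of all elements not above that cycle, shows that `⟨λ_i, ρ_i⟩` itself contains
arbitrarily long Mal'cev sequences avoiding this ideal (`IsPseudoNilpotent.exists_cycle`). For two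
elements `x`, `y` of the `𝓙`-class of the cycle this is very restrictive: `x * y` and `y * x` stay in
the class (`jle_mul_of_persistent`), and `x`, `y` do not lie in a common subgroup
(`IsPseudoNilpotent.malcev_eq_of_group`: translating the sequence by `x⁻¹` turns `x` into the
identity, and then the initial elements commute).

Call a `𝓙`-class persistent if arbitrarily long Mal'cev sequences stay in it, equivalently, if the
principal factor is not nilpotent. In terms of the sandwich matrix of such a class, two rows with a
common non-zero column may be moved to any other column by a parameter of the sequence, and the
restrictions above force non-zero entries there. Hence the class is a completely simple
subsemigroup with more than one `𝓗`-class (`IsPseudoNilpotent.jle_mul_of_mem`,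
`IsPseudoNilpotent.exists_pair`), on which all elements above it act
(`IsPseudoNilpotent.mul_mem_jClass`). A Mal'cev sequence in it changes `𝓛`-classes and keeps
`𝓡`-classes, so it never collapses when started from elements that are not `𝓗`-related; a first
step with a parameter in the class makes this available for an arbitrary element above the class.
So all elements above a persistent class lie in one component (`IsPseudoNilpotent.reachable`).
Conversely, below two adjacent elements there is a persistent class
(`IsPseudoNilpotent.exists_persistent_of_adj`).

The layers of the principal series are the `𝓙`-classes, the stem of a persistent layer is the set of
elements above it, every element above a persistent layer is above a root, and `K` consists of the
elements above no persistent layer (`PrincipalSeries.mem_K_iff`), that is, of the isolated vertices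
of the graph. The factors of a product outside `K` lie above the same root as the product,
hence in the same component.
-/

/-! ### Green's preorders in a finite monoid -/

section Green

variable {M : Type*} [Monoid M]

/-- The `𝓙`-preorder of a monoid: `a` lies in the two-sided ideal generated by `b`. -/
def JLe (a b : M) : Prop := ∃ u v, a = u * b * v

/-- The principal left ideal generated by `a`; two elements are `𝓛`-related if these agree. -/
def lIdeal (a : M) : Set M := {s | ∃ u, s = u * a}

/-- The principal right ideal generated by `a`; two elements are `𝓡`-related if these agree. -/
def rIdeal (a : M) : Set M := {s | ∃ u, s = a * u}

theorem JLe.refl (a : M) : JLe a a := ⟨1, 1, by simp⟩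

theorem JLe.trans {a b c : M} (h₁ : JLe a b) (h₂ : JLe b c) : JLe a c := by
  obtain ⟨u, v, rfl⟩ := h₁
  obtain ⟨p, q, rfl⟩ := h₂
  exact ⟨u * p, q * v, by simp only [mul_assoc]⟩

theorem jle_mul_left (a b : M) : JLe (a * b) b := ⟨a, 1, by simp⟩

theorem jle_mul_right (a b : M) : JLe (a * b) a := ⟨1, b, by simp⟩

theorem JLe.of_mul_left {z a b : M} (h : JLe z (a * b)) : JLe z b := h.trans (jle_mul_left a b)

theorem JLe.of_mul_right {z a b : M} (h : JLe z (a * b)) : JLe z a := h.trans (jle_mul_right a b)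

theorem exists_eq_mul_of_lIdeal_eq {a b : M} (h : lIdeal a = lIdeal b) : ∃ u, a = u * b :=
  (h ▸ ⟨1, by simp⟩ : a ∈ lIdeal b)

theorem exists_eq_mul_of_rIdeal_eq {a b : M} (h : rIdeal a = rIdeal b) : ∃ u, a = b * u :=
  (h ▸ ⟨1, by simp⟩ : a ∈ rIdeal b)

theorem JLe.congr_left {z a b c : M} (h : JLe z (a * c)) (hab : lIdeal a = lIdeal b) :
    JLe z (b * c) := by
  obtain ⟨u, rfl⟩ := exists_eq_mul_of_lIdeal_eq hab
  rw [mul_assoc] at h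
  exact h.of_mul_left

theorem JLe.congr_right {z a b c : M} (h : JLe z (c * a)) (hab : rIdeal a = rIdeal b) :
    JLe z (c * b) := by
  obtain ⟨u, rfl⟩ := exists_eq_mul_of_rIdeal_eq hab
  rw [← mul_assoc] at h
  exact h.of_mul_right

/-- Stability: in a finite monoid, a left multiple of `a` in the `𝓙`-class of `a` is `𝓛`-related
to `a`. -/
theorem lIdeal_mul_eq [Finite M] {a u : M} (h : JLe a (u * a)) : lIdeal (u * a) = lIdeal a := by
  obtain ⟨p, q, hpq⟩ := h
  have hg : ∀ n : ℕ, (p * u) ^ n * a * q ^ n = a := by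
    intro n
    induction n with
    | zero => simp
    | succ n ih =>
      calc (p * u) ^ (n + 1) * a * q ^ (n + 1) = (p * u) ^ n * (p * (u * a) * q) * q ^ n := by
            rw [pow_succ, pow_succ']; simp only [mul_assoc]
        _ = a := by rw [← hpq, ih]
  -- the powers of `p * u` applied to `a` repeat, and a repetition can be moved back to `a`
  obtain ⟨i, j, hij, he⟩ := Finite.exists_ne_map_eq_of_infinite fun n : ℕ => (p * u) ^ n * a
  have key : ∀ i j : ℕ, i < j → (p * u) ^ i * a = (p * u) ^ j * a → ∃ v, a = v * (u * a) := by
    intro i j hlt he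
    obtain ⟨k, rfl⟩ := Nat.exists_eq_add_of_lt hlt
    refine ⟨(p * u) ^ k * p, ?_⟩
    calc a = (p * u) ^ i * a * q ^ i := (hg i).symm
      _ = (p * u) ^ (k + 1 + i) * a * q ^ i := by rw [he, show i + k + 1 = k + 1 + i by omega]
      _ = (p * u) ^ (k + 1) * ((p * u) ^ i * a * q ^ i) := by
          rw [pow_add]; simp only [mul_assoc]
      _ = (p * u) ^ k * p * (u * a) := by rw [hg i, pow_succ]; simp only [mul_assoc]
  obtain ⟨v, hv⟩ : ∃ v, a = v * (u * a) := by
    rcases lt_or_gt_of_ne hij with h | h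
    · exact key i j h he
    · exact key j i h he.symm
  ext s
  constructor
  · rintro ⟨w, rfl⟩; exact ⟨w * u, by simp only [mul_assoc]⟩
  · rintro ⟨w, rfl⟩; exact ⟨w * v, by rw [mul_assoc, ← hv]⟩

/-- Stability, for right multiples. -/
theorem rIdeal_mul_eq [Finite M] {a u : M} (h : JLe a (a * u)) : rIdeal (a * u) = rIdeal a := by
  have hop : JLe (MulOpposite.op a) (MulOpposite.op u * MulOpposite.op a) := by
    obtain ⟨p, q, hpq⟩ := h
    exact ⟨MulOpposite.op q, MulOpposite.op p, MulOpposite.unop_injective (by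
      simpa [mul_assoc] using hpq)⟩
  have : Finite Mᵐᵒᵖ := Finite.of_equiv M MulOpposite.opEquiv
  have hl := lIdeal_mul_eq hop
  ext s
  have hs := Set.ext_iff.1 hl (MulOpposite.op s)
  have hmem : ∀ b : M, MulOpposite.op s ∈ lIdeal (MulOpposite.op b) ↔ s ∈ rIdeal b := by
    intro b
    constructor
    · rintro ⟨w, hw⟩
      exact ⟨w.unop, by simpa using congrArg MulOpposite.unop hw⟩
    · rintro ⟨w, rfl⟩
      exact ⟨MulOpposite.op w, by simp⟩
  rw [← MulOpposite.op_mul, hmem, hmem] at hs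
  exact hs

end Green

section WithOneLemmas

variable {S : Type*} [Semigroup S]

instance WithOne.instFinite [Finite S] : Finite (WithOne S) :=
  inferInstanceAs (Finite (Option S))

theorem WithOne.exists_coe_mul (u : WithOne S) (a : S) :
    ∃ b : S, (b : WithOne S) = u * (a : WithOne S) := by
  induction u using WithOne.recOneCoe with
  | one => exact ⟨a, by simp⟩
  | coe s => exact ⟨s * a, by simp⟩

theorem WithOne.exists_coe_mul' (u : WithOne S) (a : S) :
    ∃ b : S, (b : WithOne S) = (a : WithOne S) * u := by
  induction u using WithOne.recOneCoe with
  | one => exact ⟨a, by simp⟩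
  | coe s => exact ⟨a * s, by simp⟩

theorem coe_sandwich (a : S) (w : WithOne S) (b : S) :
    ((sandwich a w b : S) : WithOne S) = (a : WithOne S) * w * (b : WithOne S) := by
  induction w using WithOne.recOneCoe with
  | one => rw [mul_one]; rfl
  | coe s => rfl

theorem sandwich_comm {a b : S} {w : WithOne S} (hab : a * b = b * a)
    (hw : ∀ s : S, w = s → a * s = s * a ∧ b * s = s * b) :
    sandwich a w b = sandwich b w a := by
  induction w using WithOne.recOneCoe with
  | one => exact hab
  | coe s =>
    obtain ⟨h₁, h₂⟩ := hw s rfl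
    change a * s * b = b * s * a
    rw [h₁, mul_assoc, hab, ← mul_assoc, ← h₂]

theorem map_sandwich {U : Type*} [Semigroup U] (f : S →ₙ* U) (a : S) (w : WithOne S) (b : S) :
    f (sandwich a w b) = sandwich (f a) (WithOne.mapMulHom f w) (f b) := by
  induction w using WithOne.recOneCoe with
  | one => exact map_mul f a b
  | coe s =>
    change f (a * s * b) = f a * f s * f b
    rw [map_mul, map_mul]

/-- Membership in an ideal passes down the `𝓙`-preorder. -/
theorem IsSemigroupIdeal.mem_of_jle {I : Set S} (hI : IsSemigroupIdeal I) {a b : S}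
    (h : JLe (a : WithOne S) b) (hb : b ∈ I) : a ∈ I := by
  obtain ⟨u, v, h⟩ := h
  obtain ⟨c, hc⟩ := WithOne.exists_coe_mul u b
  have hcI : c ∈ I := by
    induction u using WithOne.recOneCoe with
    | one => rw [one_mul, WithOne.coe_inj] at hc; rwa [hc]
    | coe s => rw [← WithOne.coe_mul, WithOne.coe_inj] at hc; rw [hc]; exact (hI b hb s).1
  rw [← hc] at h
  induction v using WithOne.recOneCoe with
  | one => rw [mul_one, WithOne.coe_inj] at h; rwa [h]
  | coe s => rw [← WithOne.coe_mul, WithOne.coe_inj] at h; rw [h]; exact (hI c hcI s).2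

/-- The elements not lying `𝓙`-above `z` form an ideal. -/
theorem isSemigroupIdeal_not_jle (z : WithOne S) :
    IsSemigroupIdeal {s : S | ¬ JLe z s} := fun a ha s =>
  ⟨fun h => ha (by rw [WithOne.coe_mul] at h; exact h.of_mul_left),
    fun h => ha (by rw [WithOne.coe_mul] at h; exact h.of_mul_right)⟩

theorem isSemigroupIdeal_jle (z : WithOne S) : IsSemigroupIdeal {s : S | JLe (s : WithOne S) z} :=
  fun a ha s => ⟨by
    have := (jle_mul_left (s : WithOne S) a).trans ha
    rwa [← WithOne.coe_mul] at this, by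
    have := (jle_mul_right (a : WithOne S) s).trans ha
    rwa [← WithOne.coe_mul] at this⟩

end WithOneLemmas

/-! ### The sequences `λ_n`, `ρ_n` -/

section Malcev

variable {S : Type*} [Semigroup S]

theorem malcevLam_succ (x y : S) (w : ℕ → WithOne S) (n : ℕ) :
    malcevLam x y w (n + 1) = sandwich (malcevLam x y w n) (w n) (malcevRho x y w n) := rfl

theorem malcevRho_succ (x y : S) (w : ℕ → WithOne S) (n : ℕ) :
    malcevRho x y w (n + 1) = sandwich (malcevRho x y w n) (w n) (malcevLam x y w n) := rfl

theorem coe_malcevLam_succ (x y : S) (w : ℕ → WithOne S) (n : ℕ) :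
    ((malcevLam x y w (n + 1) : S) : WithOne S) = malcevLam x y w n * w n * malcevRho x y w n :=
  coe_sandwich _ _ _

theorem coe_malcevRho_succ (x y : S) (w : ℕ → WithOne S) (n : ℕ) :
    ((malcevRho x y w (n + 1) : S) : WithOne S) = malcevRho x y w n * w n * malcevLam x y w n :=
  coe_sandwich _ _ _

theorem malcevPair_map {U : Type*} [Semigroup U] (f : S →ₙ* U) (x y : S) (w : ℕ → WithOne S)
    (n : ℕ) :
    malcevLam (f x) (f y) (fun k => WithOne.mapMulHom f (w k)) n = f (malcevLam x y w n) ∧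
      malcevRho (f x) (f y) (fun k => WithOne.mapMulHom f (w k)) n = f (malcevRho x y w n) := by
  induction n with
  | zero => exact ⟨rfl, rfl⟩
  | succ n ih =>
    simp only [malcevLam_succ, malcevRho_succ, ih.1, ih.2, map_sandwich, and_self]

theorem malcevPair_add (x y : S) (w : ℕ → WithOne S) (t n : ℕ) :
    malcevLam x y w (t + n) =
        malcevLam (malcevLam x y w t) (malcevRho x y w t) (fun k => w (t + k)) n ∧
      malcevRho x y w (t + n) =
        malcevRho (malcevLam x y w t) (malcevRho x y w t) (fun k => w (t + k)) n := by
  induction n with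
  | zero => exact ⟨rfl, rfl⟩
  | succ n ih =>
    rw [← add_assoc]
    simp only [malcevLam_succ, malcevRho_succ, ih.1, ih.2, and_self]

theorem malcevPair_congr (x y : S) {w w' : ℕ → WithOne S} {n : ℕ} (h : ∀ k < n, w k = w' k) :
    malcevLam x y w n = malcevLam x y w' n ∧ malcevRho x y w n = malcevRho x y w' n := by
  induction n with
  | zero => exact ⟨rfl, rfl⟩
  | succ n ih =>
    have := ih fun k hk => h k (by omega)
    simp only [malcevLam_succ, malcevRho_succ, this.1, this.2, h n (by omega), and_self]

theorem malcev_ne_of_le {x y : S} {w : ℕ → WithOne S} {n k : ℕ} (hk : k ≤ n)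
    (h : malcevLam x y w n ≠ malcevRho x y w n) : malcevLam x y w k ≠ malcevRho x y w k := by
  intro he
  apply h
  induction n, hk using Nat.le_induction with
  | base => exact he
  | succ n hn ih =>
    have := ih (fun h' => h (by rw [malcevLam_succ, malcevRho_succ, h']))
    rw [malcevLam_succ, malcevRho_succ, this]

/-- Later terms of a Mal'cev sequence lie `𝓙`-below all earlier terms. -/
theorem malcev_jle {x y : S} {w : ℕ → WithOne S} {t n : ℕ} (h : t < n) :
    (JLe ((malcevLam x y w n : S) : WithOne S) ((malcevLam x y w t : S) : WithOne S) ∧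
      JLe ((malcevLam x y w n : S) : WithOne S) ((malcevRho x y w t : S) : WithOne S)) ∧
    (JLe ((malcevRho x y w n : S) : WithOne S) ((malcevLam x y w t : S) : WithOne S) ∧
      JLe ((malcevRho x y w n : S) : WithOne S) ((malcevRho x y w t : S) : WithOne S)) := by
  induction n, Nat.succ_le_of_lt h using Nat.le_induction with
  | base =>
    rw [Nat.succ_eq_add_one, coe_malcevLam_succ, coe_malcevRho_succ]
    exact ⟨⟨(JLe.refl _).of_mul_right.of_mul_right, (JLe.refl _).of_mul_left⟩,
      ⟨(JLe.refl _).of_mul_left, (JLe.refl _).of_mul_right.of_mul_right⟩⟩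
  | succ n hn ih =>
    obtain ⟨⟨h₁, h₂⟩, h₃, h₄⟩ := ih (by omega)
    rw [coe_malcevLam_succ, coe_malcevRho_succ]
    exact ⟨⟨(jle_mul_left _ _).trans h₃, (jle_mul_left _ _).trans h₄⟩,
      ⟨(jle_mul_left _ _).trans h₁, (jle_mul_left _ _).trans h₂⟩⟩

/-- A set `A` is persistent if there are arbitrarily long Mal'cev sequences of pairs of distinct
elements all of whose terms and parameters (other than the adjoined identity) lie in `A`. For a
subsemigroup this is the failure of nilpotency, but the notion is also needed for `𝓙`-classes. -/
def Persistent (A : Set S) : Prop :=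
  ∀ n : ℕ, ∃ (a b : S) (c : ℕ → WithOne S), (∀ i (s : S), c i = s → s ∈ A) ∧
    (∀ k ≤ n, malcevLam a b c k ∈ A ∧ malcevRho a b c k ∈ A) ∧
      malcevLam a b c n ≠ malcevRho a b c n

theorem Persistent.mono {A B : Set S} (h : Persistent A) (hAB : A ⊆ B) : Persistent B := by
  intro n
  obtain ⟨a, b, c, h₁, h₂, h₃⟩ := h n
  exact ⟨a, b, c, fun i s hs => hAB (h₁ i s hs), fun k hk => ⟨hAB (h₂ k hk).1, hAB (h₂ k hk).2⟩, h₃⟩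

theorem Persistent.image {U : Type*} [Semigroup U] {A : Set U} (h : Persistent A) (f : U →ₙ* S)
    (hf : Function.Injective f) : Persistent (f '' A) := by
  intro n
  obtain ⟨a, b, c, h₁, h₂, h₃⟩ := h n
  refine ⟨f a, f b, fun k => WithOne.mapMulHom f (c k), ?_, ?_, ?_⟩
  · intro i s hs
    cases hc : c i using WithOne.recOneCoe with
    | one => simp [hc] at hs
    | coe u =>
      simp only [hc, WithOne.mapMulHom_coe, WithOne.coe_inj] at hs
      exact ⟨u, h₁ i u hc, hs⟩
  · intro k hk
    rw [(malcevPair_map f a b c k).1, (malcevPair_map f a b c k).2]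
    exact ⟨⟨_, (h₂ k hk).1, rfl⟩, ⟨_, (h₂ k hk).2, rfl⟩⟩
  · rw [(malcevPair_map f a b c n).1, (malcevPair_map f a b c n).2]
    exact fun h => h₃ (hf h)

/-- A Mal'cev sequence in `A ⊆ S` lifts along `f` and is then mapped along `g`. With `g` the
identity this says that a subsemigroup that is a persistent set is not nilpotent; with `g` a
canonical map to a Rees factor it treats principal factors. -/
theorem Persistent.not_isMalcevNilpotent {U Q : Type*} [Semigroup U] [Semigroup Q] {A : Set S}
    (h : Persistent A) (f : U →ₙ* S) (hA : A ⊆ Set.range f) (g : U →ₙ* Q)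
    (hg : ∀ u v, f u ∈ A → f v ∈ A → g u = g v → f u = f v) : ¬ IsMalcevNilpotent Q := by
  rintro ⟨n, -, hn⟩
  obtain ⟨a, b, c, h₁, h₂, h₃⟩ := h n
  obtain ⟨a, rfl⟩ := hA (h₂ 0 (by omega)).1
  obtain ⟨b, rfl⟩ : b ∈ Set.range f := hA (h₂ 0 (by omega)).2
  have hc : ∀ i, ∃ w : WithOne U, WithOne.mapMulHom f w = c i := by
    intro i
    cases hci : c i using WithOne.recOneCoe with
    | one => exact ⟨1, map_one _⟩
    | coe s =>
      obtain ⟨u, rfl⟩ := hA (h₁ i s hci)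
      exact ⟨u, WithOne.mapMulHom_coe f u⟩
  choose c' hc' using hc
  obtain rfl : (fun i => WithOne.mapMulHom f (c' i)) = c := funext hc'
  have h₂ := h₂ n le_rfl
  rw [(malcevPair_map f a b c' n).1, (malcevPair_map f a b c' n).2] at h₂ h₃
  refine h₃ (hg _ _ h₂.1 h₂.2 ?_)
  rw [← (malcevPair_map g a b c' n).1, ← (malcevPair_map g a b c' n).2]
  exact hn _ _ _

theorem exists_malcev_ne (h : ¬ IsMalcevNilpotent S) (n : ℕ) :
    ∃ (a b : S) (c : ℕ → WithOne S), malcevLam a b c n ≠ malcevRho a b c n := by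
  by_contra! hn
  exact h ⟨n + 1, by omega, fun a b c => by
    rw [malcevLam_succ, malcevRho_succ, hn]⟩

/-- If a semigroup embeds in a Rees factor `S / I` and is not nilpotent, then there are arbitrarily
long Mal'cev sequences in its preimage that avoid `I`. -/
theorem persistent_of_not_isMalcevNilpotent {V : Type*} [Semigroup V] {I : Set S}
    (hI : IsSemigroupIdeal I) (φ : V →ₙ* ReesQuotient I hI) (hφ : Function.Injective φ)
    (hV : ¬ IsMalcevNilpotent V) :
    Persistent {s : S | s ∉ I ∧ ReesQuotient.mk I hI s ∈ Set.range φ} := by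
  let π : S →ₙ* ReesQuotient I hI := ⟨ReesQuotient.mk I hI, fun _ _ => rfl⟩
  have hπ : Function.Surjective π := Quotient.mk''_surjective
  have hπI : ∀ a b : S, a ∈ I → b ∈ I → π a = π b := fun a b ha hb =>
    (Con.eq _).2 (Or.inr ⟨ha, hb⟩)
  intro n
  obtain ⟨a, b, c, hne⟩ := exists_malcev_ne hV (n + 1)
  obtain ⟨a', ha⟩ := hπ (φ a)
  obtain ⟨b', hb⟩ := hπ (φ b)
  have hc : ∀ i, ∃ w : WithOne S, WithOne.mapMulHom π w = WithOne.mapMulHom φ (c i) := by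
    intro i
    cases c i using WithOne.recOneCoe with
    | one => exact ⟨1, by simp⟩
    | coe s =>
      obtain ⟨u, hu⟩ := hπ (φ s)
      exact ⟨u, by simp [hu]⟩
  choose c' hc' using hc
  have hmap : ∀ k, π (malcevLam a' b' c' k) = φ (malcevLam a b c k) ∧
      π (malcevRho a' b' c' k) = φ (malcevRho a b c k) := by
    intro k
    rw [← (malcevPair_map π a' b' c' k).1, ← (malcevPair_map π a' b' c' k).2,
      ← (malcevPair_map φ a b c k).1, ← (malcevPair_map φ a b c k).2, ha, hb, funext hc']
    exact ⟨rfl, rfl⟩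
  -- entering `I` would make the next pair collapse in `S / I`
  have hnext : ∀ k ≤ n, ¬ (malcevLam a' b' c' (k + 1) ∈ I ∧ malcevRho a' b' c' (k + 1) ∈ I) :=
    fun k hk hmem => malcev_ne_of_le (show k + 1 ≤ n + 1 by omega) hne (hφ (by
      rw [← (hmap _).1, ← (hmap _).2]
      exact hπI _ _ hmem.1 hmem.2))
  have hjle : ∀ k ≤ n, ∀ s ∈ I, ¬ (JLe ((malcevLam a' b' c' (k + 1) : S) : WithOne S) s ∧
      JLe ((malcevRho a' b' c' (k + 1) : S) : WithOne S) s) := fun k hk s hs h =>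
    hnext k hk ⟨hI.mem_of_jle h.1 hs, hI.mem_of_jle h.2 hs⟩
  have hcongr : ∀ k ≤ n,
      malcevLam a' b' (fun i => if i < n then c' i else 1) k = malcevLam a' b' c' k ∧
      malcevRho a' b' (fun i => if i < n then c' i else 1) k = malcevRho a' b' c' k :=
    fun k hk => malcevPair_congr _ _ fun i hi => if_pos (by omega)
  refine ⟨a', b', fun i => if i < n then c' i else 1, ?_, ?_, ?_⟩
  · intro i s hs
    by_cases hi : i < n
    · simp only [hi, if_true] at hs
      refine ⟨fun hsI => hjle i (by omega) s hsI ⟨?_, ?_⟩, ?_⟩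
      · rw [coe_malcevLam_succ, hs]; exact (JLe.refl _).of_mul_right.of_mul_left
      · rw [coe_malcevRho_succ, hs]; exact (JLe.refl _).of_mul_right.of_mul_left
      · have := hc' i
        rw [hs] at this
        cases hci : c i using WithOne.recOneCoe with
        | one => simp [hci] at this
        | coe v =>
          rw [hci, WithOne.mapMulHom_coe, WithOne.mapMulHom_coe, WithOne.coe_inj] at this
          exact ⟨v, this.symm⟩
    · simp [hi] at hs
  · intro k hk
    rw [(hcongr k hk).1, (hcongr k hk).2]
    have := malcev_jle (x := a') (y := b') (w := c') (show k < k + 1 by omega)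
    exact ⟨⟨fun hs => hjle k hk _ hs ⟨this.1.1, this.2.1⟩, ⟨_, (hmap k).1.symm⟩⟩,
      ⟨fun hs => hjle k hk _ hs ⟨this.1.2, this.2.2⟩, ⟨_, (hmap k).2.symm⟩⟩⟩
  · rw [(hcongr n le_rfl).1, (hcongr n le_rfl).2]
    intro he
    refine malcev_ne_of_le (show n ≤ n + 1 by omega) hne (hφ ?_)
    rw [← (hmap n).1, ← (hmap n).2, he]

/-- A subsemigroup is not nilpotent if and only if it is persistent. -/
theorem not_isMalcevNilpotent_iff (T : Subsemigroup S) :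
    ¬ IsMalcevNilpotent T ↔ Persistent (T : Set S) := by
  constructor
  · intro h n
    have huniv : Persistent (Set.univ : Set T) := fun n =>
      have ⟨a, b, c, hne⟩ := exists_malcev_ne h n
      ⟨a, b, c, fun _ _ _ => trivial, fun _ _ => ⟨trivial, trivial⟩, hne⟩
    refine (huniv.image (MulMemClass.subtype T) Subtype.val_injective).mono ?_ n
    rintro _ ⟨t, -, rfl⟩
    exact t.2
  · intro h
    exact h.not_isMalcevNilpotent (MulMemClass.subtype T) (fun s hs => ⟨⟨s, hs⟩, rfl⟩)
      (MulHom.id T) fun u v _ _ huv => congrArg Subtype.val huv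

end Malcev

/-! ### Consequences of pseudo-nilpotency for a single Mal'cev sequence -/

section Core

variable {S : Type*} [Semigroup S]

/-- The length from which on a Mal'cev sequence in a finite semigroup must repeat a pair. -/
noncomputable def malcevBound (S : Type*) : ℕ := Nat.card (S × S)

theorem exists_malcevPair_eq [Finite S] (x y : S) (w : ℕ → WithOne S) :
    ∃ t m, t < m ∧ m ≤ malcevBound S ∧ malcevLam x y w t = malcevLam x y w m ∧
      malcevRho x y w t = malcevRho x y w m := by
  have := Fintype.ofFinite (S × S)
  obtain ⟨i, j, hij, he⟩ := Fintype.exists_ne_map_eq_of_card_lt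
    (fun i : Fin (malcevBound S + 1) => malcevPair x y w i)
    (by rw [Fintype.card_fin, malcevBound, Nat.card_eq_fintype_card]; omega)
  have he' : malcevPair x y w i = malcevPair x y w j := he
  have hij' : (i : ℕ) ≠ j := fun h => hij (Fin.ext h)
  rcases lt_or_gt_of_ne hij' with h | h
  · exact ⟨i, j, h, by omega, congrArg Prod.fst he', congrArg Prod.snd he'⟩
  · exact ⟨j, i, h, by omega, congrArg Prod.fst he'.symm, congrArg Prod.snd he'.symm⟩

/-- The basic consequence of pseudo-nilpotency: if a Mal'cev sequence does not collapse, it enters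
a cycle, and already the two-generated subsemigroup `⟨λ_i, ρ_i⟩` is persistent, even when restricted
to the elements that lie `𝓙`-above the cycle. The definition is applied to the ideal of all
elements of `T` that are not `𝓙`-above the cycle in `S`. -/
theorem IsPseudoNilpotent.exists_cycle [Finite S] (hS : IsPseudoNilpotent S) {x y : S}
    {w : ℕ → WithOne S}
    (h : malcevLam x y w (malcevBound S) ≠ malcevRho x y w (malcevBound S)) :
    ∃ t m, t < m ∧ m ≤ malcevBound S ∧ malcevLam x y w t = malcevLam x y w m ∧
      malcevRho x y w t = malcevRho x y w m ∧ ∀ i ≤ m,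
        Persistent {s : S | s ∈ Subsemigroup.closure {malcevLam x y w i, malcevRho x y w i} ∧
          JLe ((malcevLam x y w m : S) : WithOne S) s} := by
  obtain ⟨t, m, htm, hm, h₁, h₂⟩ := exists_malcevPair_eq x y w
  refine ⟨t, m, htm, hm, h₁, h₂, fun i hi => ?_⟩
  set z := malcevLam x y w m with hz
  have hI := (isSemigroupIdeal_not_jle (z : WithOne S)).preimage (malcevGen x y w m)
  obtain ⟨-, hnil⟩ := hS t m x y w htm (malcev_ne_of_le (htm.le.trans hm) h) h₁ h₂ _ hI
    (fun hn => hn (JLe.refl _))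
    (fun hn => hn (by
      have := (malcev_jle (x := x) (y := y) (w := w) htm).1.2
      rwa [h₂] at this)) i hi
  have hP := persistent_of_not_isMalcevNilpotent hI (MulMemClass.subtype _)
    Subtype.val_injective hnil
  refine (hP.image (MulMemClass.subtype (malcevGen x y w m)) Subtype.val_injective).mono ?_
  rintro _ ⟨s, ⟨hsI, ⟨q, hq⟩⟩, rfl⟩
  have hsz : JLe (z : WithOne S) (s : S) := not_not.1 hsI
  refine ⟨?_, hsz⟩
  have hlift : ∀ q ∈ Subsemigroup.closure ({ReesQuotient.mk _ hI (malcevLamGen x y w m i hi),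
      ReesQuotient.mk _ hI (malcevRhoGen x y w m i hi)} : Set (ReesQuotient _ hI)),
      ∃ s : malcevGen x y w m,
        (s : S) ∈ Subsemigroup.closure {malcevLam x y w i, malcevRho x y w i} ∧
          ReesQuotient.mk _ hI s = q := by
    intro q hq
    induction hq using Subsemigroup.closure_induction with
    | mem q hq =>
      rcases hq with rfl | rfl
      · exact ⟨malcevLamGen x y w m i hi, Subsemigroup.subset_closure (Or.inl rfl), rfl⟩
      · exact ⟨malcevRhoGen x y w m i hi, Subsemigroup.subset_closure (Or.inr rfl), rfl⟩
    | mul p q _ _ hp hq =>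
      obtain ⟨s, hs, rfl⟩ := hp
      obtain ⟨s', hs', rfl⟩ := hq
      exact ⟨s * s', mul_mem hs hs', rfl⟩
  obtain ⟨s', hs', hq'⟩ := hlift q.1 q.2
  rcases (Con.eq _).1 (hq'.trans hq) with rfl | ⟨-, hn⟩
  · exact hs'
  · exact absurd hn hsI

theorem upperNonNilpotentGraph_adj_of_persistent {x y : S} (hne : x ≠ y)
    (h : Persistent (Subsemigroup.closure {x, y} : Set S)) :
    (upperNonNilpotentGraph S).Adj x y :=
  ⟨hne, (not_isMalcevNilpotent_iff _).2 h⟩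

theorem IsPseudoNilpotent.adj [Finite S] (hS : IsPseudoNilpotent S) {x y : S}
    {w : ℕ → WithOne S}
    (h : malcevLam x y w (malcevBound S) ≠ malcevRho x y w (malcevBound S)) :
    (upperNonNilpotentGraph S).Adj x y := by
  obtain ⟨t, m, -, -, -, -, hP⟩ := hS.exists_cycle h
  exact upperNonNilpotentGraph_adj_of_persistent
    (malcev_ne_of_le (k := 0) (Nat.zero_le _) h) ((hP 0 (Nat.zero_le _)).mono fun s hs => hs.1)

theorem mul_comm_of_mem_closure_singleton {x p q : S} (hp : p ∈ Subsemigroup.closure {x})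
    (hq : q ∈ Subsemigroup.closure {x}) : p * q = q * p := by
  induction hp, hq using Subsemigroup.closure_induction₂ with
  | mem p q hp hq => rw [Set.mem_singleton_iff.1 hp, Set.mem_singleton_iff.1 hq]
  | mul_left p q r _ _ _ h₁ h₂ => rw [mul_assoc, h₂, ← mul_assoc, h₁, mul_assoc]
  | mul_right p q r _ _ _ h₁ h₂ => rw [← mul_assoc, h₁, mul_assoc, h₂, mul_assoc]

/-- A persistent set contains elements `p`, `q` and a parameter `v` with `p v q ≠ q v p`. -/
theorem Persistent.exists_sandwich_ne {A : Set S} (h : Persistent A) :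
    ∃ p ∈ A, ∃ q ∈ A, ∃ v : WithOne S, (∀ s : S, v = s → s ∈ A) ∧
      sandwich p v q ∈ A ∧ sandwich q v p ∈ A ∧ sandwich p v q ≠ sandwich q v p := by
  obtain ⟨p, q, c, h₁, h₂, h₃⟩ := h 1
  exact ⟨p, (h₂ 0 (by omega)).1, q, (h₂ 0 (by omega)).2, c 0, h₁ 0, (h₂ 1 le_rfl).1,
    (h₂ 1 le_rfl).2, h₃⟩

theorem not_persistent_of_commute {A : Set S} (hA : ∀ p ∈ A, ∀ q ∈ A, p * q = q * p) :
    ¬ Persistent A := by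
  intro h
  obtain ⟨p, hp, q, hq, v, hv, -, -, hne⟩ := h.exists_sandwich_ne
  exact hne (sandwich_comm (hA p hp q hq) fun s hs => ⟨hA p hp s (hv s hs), hA q hq s (hv s hs)⟩)

section TwoGenerated

variable {z : WithOne S} {x y : S}

/-- If `x * y` is not `𝓙`-above `z`, then a word in `x`, `y` that is `𝓙`-above `z` after
multiplication by `x` on the left is a power of `x`. -/
theorem mem_closure_left_of_jle (hxy : ¬ JLe z (x * y : S)) {r : S}
    (hr : r ∈ Subsemigroup.closure {x, y}) (h : JLe z (x * r : S)) :
    r ∈ Subsemigroup.closure {x} := by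
  induction hr using Subsemigroup.closure_induction with
  | mem r hr =>
    rcases hr with rfl | rfl
    · exact Subsemigroup.subset_closure rfl
    · exact absurd h hxy
  | mul r s _ _ h₁ h₂ =>
    have hr := h₁ (by rw [← mul_assoc, WithOne.coe_mul] at h; exact h.of_mul_right)
    refine mul_mem hr (h₂ ?_)
    rw [← mul_assoc, mul_comm_of_mem_closure_singleton (Subsemigroup.subset_closure rfl) hr,
      mul_assoc, WithOne.coe_mul] at h
    exact h.of_mul_left

theorem mem_closure_right_of_jle (hxy : ¬ JLe z (x * y : S)) {r : S}
    (hr : r ∈ Subsemigroup.closure {x, y}) (h : JLe z (r * y : S)) :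
    r ∈ Subsemigroup.closure {y} := by
  induction hr using Subsemigroup.closure_induction with
  | mem r hr =>
    rcases hr with rfl | rfl
    · exact absurd h hxy
    · exact Subsemigroup.subset_closure rfl
  | mul r s _ _ h₁ h₂ =>
    have hs := h₂ (by rw [mul_assoc, WithOne.coe_mul] at h; exact h.of_mul_left)
    refine mul_mem (h₁ ?_) hs
    rw [mul_assoc, mul_comm_of_mem_closure_singleton hs (Subsemigroup.subset_closure rfl),
      ← mul_assoc, WithOne.coe_mul] at h
    exact h.of_mul_right

theorem jle_left_of_mem_closure {p r : S} (hp : p ∈ Subsemigroup.closure {x})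
    (h : JLe z (p * r : S)) : JLe z (x * r : S) := by
  induction hp using Subsemigroup.closure_induction with
  | mem p hp => rwa [← Set.mem_singleton_iff.1 hp]
  | mul p q _ _ _ h₂ =>
    rw [mul_assoc, WithOne.coe_mul] at h
    exact h₂ h.of_mul_left

theorem jle_right_of_mem_closure {p r : S} (hp : p ∈ Subsemigroup.closure {y})
    (h : JLe z (r * p : S)) : JLe z (r * y : S) := by
  induction hp using Subsemigroup.closure_induction with
  | mem p hp => rwa [← Set.mem_singleton_iff.1 hp]
  | mul p q _ _ h₁ _ =>
    rw [← mul_assoc, WithOne.coe_mul] at h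
    exact h₁ h.of_mul_right

/-- A word in `x`, `y` that is `𝓙`-above `z` is a power of `x` or begins with `y`. -/
theorem mem_closure_or_begins (hxy : ¬ JLe z (x * y : S)) {p : S}
    (hp : p ∈ Subsemigroup.closure {x, y}) (hz : JLe z p) :
    p ∈ Subsemigroup.closure {x} ∨ ∀ r : WithOne S, JLe z (r * p) → JLe z (r * y) := by
  induction hp using Subsemigroup.closure_induction with
  | mem p hp =>
    rcases hp with rfl | rfl
    · exact Or.inl (Subsemigroup.subset_closure rfl)
    · exact Or.inr fun r h => h
  | mul p q _ hq h₁ _ =>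
    have hp := h₁ (by rw [WithOne.coe_mul] at hz; exact hz.of_mul_right)
    rcases hp with hp | hp
    · exact Or.inl (mul_mem hp (mem_closure_left_of_jle hxy hq (jle_left_of_mem_closure hp hz)))
    · exact Or.inr fun r h => hp r (by
        rw [WithOne.coe_mul, ← mul_assoc] at h; exact h.of_mul_right)

/-- A word in `x`, `y` that is `𝓙`-above `z` is a power of `y` or ends with `x`. -/
theorem mem_closure_or_ends (hxy : ¬ JLe z (x * y : S)) {p : S}
    (hp : p ∈ Subsemigroup.closure {x, y}) (hz : JLe z p) :
    p ∈ Subsemigroup.closure {y} ∨ ∀ r : WithOne S, JLe z (p * r) → JLe z (x * r) := by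
  induction hp using Subsemigroup.closure_induction with
  | mem p hp =>
    rcases hp with rfl | rfl
    · exact Or.inr fun r h => h
    · exact Or.inl (Subsemigroup.subset_closure rfl)
  | mul p q hp hq _ h₂ =>
    have hq := h₂ (by rw [WithOne.coe_mul] at hz; exact hz.of_mul_left)
    rcases hq with hq | hq
    · exact Or.inl (mul_mem (mem_closure_right_of_jle hxy hp (jle_right_of_mem_closure hq hz)) hq)
    · exact Or.inr fun r h => hq r (by
        rw [WithOne.coe_mul, mul_assoc] at h; exact h.of_mul_left)

/-- If `x * y` were not above `z`, then the words in `x`, `y` above `z` would have the form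
`y ^ b * x ^ a`, and no Mal'cev sequence survives among them. -/
theorem jle_mul_of_persistent
    (h : Persistent {s : S | s ∈ Subsemigroup.closure {x, y} ∧ JLe z s}) : JLe z (x * y : S) := by
  by_contra hxy
  obtain ⟨p, ⟨hp, hpz⟩, q, ⟨hq, hqz⟩, v, hv, ⟨-, hpq⟩, ⟨-, hqp⟩, hne⟩ := h.exists_sandwich_ne
  rw [coe_sandwich] at hpq hqp
  have hX : ∀ {a b : S}, a ∈ Subsemigroup.closure {x} → b ∈ Subsemigroup.closure {x, y} →
      JLe z (a * v * b : WithOne S) → sandwich a v b = sandwich b v a := by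
    intro a b ha hb hab
    have hvX : ∀ s : S, v = s → s ∈ Subsemigroup.closure {x} := by
      rintro s rfl
      exact mem_closure_left_of_jle hxy (hv s rfl).1 (jle_left_of_mem_closure ha
        (by rw [WithOne.coe_mul]; exact hab.of_mul_right))
    have hbX : b ∈ Subsemigroup.closure {x} := by
      refine mem_closure_left_of_jle hxy hb ?_
      cases v using WithOne.recOneCoe with
      | one =>
        rw [mul_one, ← WithOne.coe_mul] at hab
        exact jle_left_of_mem_closure ha hab
      | coe s =>
        rw [← WithOne.coe_mul, ← WithOne.coe_mul] at hab
        exact jle_left_of_mem_closure (mul_mem ha (hvX s rfl)) hab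
    exact sandwich_comm (mul_comm_of_mem_closure_singleton ha hbX) fun s hs =>
      ⟨mul_comm_of_mem_closure_singleton ha (hvX s hs),
        mul_comm_of_mem_closure_singleton hbX (hvX s hs)⟩
  have hY : ∀ {a b : S}, a ∈ Subsemigroup.closure {y} → b ∈ Subsemigroup.closure {x, y} →
      JLe z (b * v * a : WithOne S) → sandwich a v b = sandwich b v a := by
    intro a b ha hb hab
    have hvY : ∀ s : S, v = s → s ∈ Subsemigroup.closure {y} := by
      rintro s rfl
      exact mem_closure_right_of_jle hxy (hv s rfl).1 (jle_right_of_mem_closure ha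
        (by rw [WithOne.coe_mul]; rw [mul_assoc] at hab; exact hab.of_mul_left))
    have hbY : b ∈ Subsemigroup.closure {y} := by
      refine mem_closure_right_of_jle hxy hb ?_
      cases v using WithOne.recOneCoe with
      | one =>
        rw [mul_one, ← WithOne.coe_mul] at hab
        exact jle_right_of_mem_closure ha hab
      | coe s =>
        rw [mul_assoc, ← WithOne.coe_mul, ← WithOne.coe_mul] at hab
        exact jle_right_of_mem_closure (mul_mem (hvY s rfl) ha) hab
    exact sandwich_comm (mul_comm_of_mem_closure_singleton ha hbY) fun s hs =>
      ⟨mul_comm_of_mem_closure_singleton ha (hvY s hs),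
        mul_comm_of_mem_closure_singleton hbY (hvY s hs)⟩
  rcases mem_closure_or_ends hxy hp hpz with hpY | hpx
  · exact hne (hY hpY hq hqp)
  rcases mem_closure_or_begins hxy hq hqz with hqX | hqy
  · exact hne (hX hqX hp hqp).symm
  -- `p` ends with `x` and `q` begins with `y`, so the word `p v q` contains `x v y`
  have hxvy : JLe z (x * v * y) := hqy _ (by rw [mul_assoc]; exact hpx _ (by rwa [← mul_assoc]))
  cases v using WithOne.recOneCoe with
  | one => exact hxy (by rwa [mul_one, ← WithOne.coe_mul] at hxvy)
  | coe s =>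
    have hs := mem_closure_left_of_jle hxy (hv s rfl).1
      (by rw [WithOne.coe_mul]; exact hxvy.of_mul_right)
    rw [mul_assoc, ← WithOne.coe_mul] at hxvy
    exact hxy (jle_left_of_mem_closure hs hxvy.of_mul_left)

end TwoGenerated

/-- No Mal'cev sequence survives in a subgroup: if `x` and `y` lie in one `𝓗`-class that is a group,
with inverse `g` of `x`, then `(x, y, w)` may be replaced by `(x * g, y * g, x * w)`, whose
first element is the identity, so that its two initial elements commute. -/
theorem IsPseudoNilpotent.malcev_eq_of_group [Finite S] (hS : IsPseudoNilpotent S) {x y : S}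
    (hl : lIdeal (x : WithOne S) = lIdeal (y : WithOne S))
    (hr : rIdeal (x : WithOne S) = rIdeal (y : WithOne S))
    (hxx : JLe (x : WithOne S) (x * x : S)) (w : ℕ → WithOne S) :
    malcevLam x y w (malcevBound S) = malcevRho x y w (malcevBound S) := by
  by_contra hne
  obtain ⟨k, hk⟩ : ∃ k : ℕ, (x : WithOne S) * (x : WithOne S) ^ (k + 1) = x := by
    rw [WithOne.coe_mul] at hxx
    obtain ⟨u, hu⟩ := exists_eq_mul_of_lIdeal_eq (lIdeal_mul_eq hxx).symm
    have hpow : ∀ n : ℕ, u ^ n * (x : WithOne S) ^ (n + 1) = x := by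
      intro n
      induction n with
      | zero => simp
      | succ n ih =>
        calc u ^ (n + 1) * (x : WithOne S) ^ (n + 1 + 1)
            = u ^ n * (u * (x * x)) * (x : WithOne S) ^ n := by
              rw [pow_succ u, pow_succ', pow_succ']; simp only [mul_assoc]
          _ = x := by rw [← hu, mul_assoc, ← pow_succ', ih]
    obtain ⟨i, j, hij, he⟩ :=
      Finite.exists_ne_map_eq_of_infinite fun n : ℕ => (x : WithOne S) ^ (n + 1)
    have key : ∀ i j : ℕ, i < j → (x : WithOne S) ^ (i + 1) = (x : WithOne S) ^ (j + 1) →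
        ∃ k : ℕ, (x : WithOne S) * (x : WithOne S) ^ (k + 1) = x := by
      intro i j hlt he
      obtain ⟨k, rfl⟩ := Nat.exists_eq_add_of_lt hlt
      refine ⟨k, ?_⟩
      nth_rewrite 1 [← hpow i]
      rw [mul_assoc, ← pow_add, show i + 1 + (k + 1) = i + k + 1 + 1 by omega, ← he, hpow i]
    rcases lt_or_gt_of_ne hij with h | h
    · exact key i j h he
    · exact key j i h he.symm
  set e : WithOne S := (x : WithOne S) ^ (k + 1) with he
  have hxe : (x : WithOne S) * e = x := hk
  have hex : e * (x : WithOne S) = x := by rw [he, ← pow_succ, pow_succ', hk]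
  have hee : e * e = e := by
    nth_rewrite 1 [he]
    rw [pow_succ, mul_assoc, hxe, ← pow_succ]
  have hxg : (x : WithOne S) * (x ^ k * e) = e := by rw [← mul_assoc, ← pow_succ', ← he, hee]
  have hgx : (x ^ k * e) * (x : WithOne S) = e := by rw [mul_assoc, hex, ← pow_succ]
  obtain ⟨e', he'⟩ : ∃ s : S, (s : WithOne S) = e := by
    obtain ⟨s, hs⟩ := WithOne.exists_coe_mul ((x : WithOne S) ^ k) x
    exact ⟨s, by rw [hs, he, pow_succ]⟩
  obtain ⟨g, hg⟩ : ∃ s : S, (s : WithOne S) = x ^ k * e := by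
    obtain ⟨s, hs⟩ := WithOne.exists_coe_mul ((x : WithOne S) ^ k) e'
    exact ⟨s, by rw [hs, he']⟩
  rw [← hg] at hxg hgx
  have hge : (g : WithOne S) * e' = g := by rw [hg, he', mul_assoc, hee]
  rw [← he'] at hxe hex hxg hgx
  obtain ⟨v, hv⟩ := exists_eq_mul_of_lIdeal_eq hl.symm
  obtain ⟨v', hv'⟩ := exists_eq_mul_of_rIdeal_eq hr.symm
  have hey : (e' : WithOne S) * y = y := by rw [hv', ← mul_assoc, hex]
  -- all terms of the sequence are left multiples of `x`, so `e` is a right identity for them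
  have hleft : ∀ n, (malcevLam x y w n : S) * (e' : WithOne S) = (malcevLam x y w n : S) ∧
      (malcevRho x y w n : S) * (e' : WithOne S) = (malcevRho x y w n : S) := by
    intro n
    induction n with
    | zero => exact ⟨hxe, by change (y : WithOne S) * e' = y; rw [hv, mul_assoc, hxe]⟩
    | succ n ih =>
      rw [coe_malcevLam_succ, coe_malcevRho_succ, mul_assoc, ih.2, mul_assoc _ _ (e' : WithOne S),
        ih.1]
      exact ⟨rfl, rfl⟩
  have hseq : ∀ n, malcevLam (x * g) (y * g) (fun i => x * w i) n = malcevLam x y w n * g ∧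
      malcevRho (x * g) (y * g) (fun i => x * w i) n = malcevRho x y w n * g := by
    intro n
    induction n with
    | zero => exact ⟨rfl, rfl⟩
    | succ n ih =>
      have hmid : ∀ a b c : WithOne S, a * e' = a →
          a * g * (x * b) * (c * g) = a * b * c * g := by
        intro a b c ha
        calc a * g * (x * b) * (c * g) = a * (g * x) * b * c * g := by simp only [mul_assoc]
          _ = a * b * c * g := by rw [hgx, ha]
      constructor
      · apply WithOne.coe_inj.1
        rw [coe_malcevLam_succ, ih.1, ih.2, WithOne.coe_mul, WithOne.coe_mul, WithOne.coe_mul,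
          coe_malcevLam_succ]
        exact hmid _ _ _ (hleft n).1
      · apply WithOne.coe_inj.1
        rw [coe_malcevRho_succ, ih.1, ih.2, WithOne.coe_mul, WithOne.coe_mul, WithOne.coe_mul,
          coe_malcevRho_succ]
        exact hmid _ _ _ (hleft n).2
  have hne' : malcevLam (x * g) (y * g) (fun i => x * w i) (malcevBound S) ≠
      malcevRho (x * g) (y * g) (fun i => x * w i) (malcevBound S) := by
    rw [(hseq _).1, (hseq _).2]
    intro h
    refine hne (WithOne.coe_inj.1 ?_)
    have := congrArg (fun s : S => (s : WithOne S) * x) h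
    simp only [WithOne.coe_mul, mul_assoc, hgx] at this
    rwa [(hleft _).1, (hleft _).2] at this
  have hcomm : ∀ p ∈ Subsemigroup.closure {x * g, y * g},
      ∀ q ∈ Subsemigroup.closure {x * g, y * g}, p * q = q * p := by
    have h0 : x * g * (y * g) = y * g * (x * g) := by
      apply WithOne.coe_inj.1
      simp only [WithOne.coe_mul, hxg]
      rw [← mul_assoc, hey, mul_assoc, hge]
    intro p hp q hq
    induction hp, hq using Subsemigroup.closure_induction₂ with
    | mem p q hp hq =>
      rcases hp with rfl | rfl <;> rcases hq with rfl | rfl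
      · rfl
      · exact h0
      · exact h0.symm
      · rfl
    | mul_left p q r _ _ _ h₁ h₂ => rw [mul_assoc, h₂, ← mul_assoc, h₁, mul_assoc]
    | mul_right p q r _ _ _ h₁ h₂ => rw [← mul_assoc, h₁, mul_assoc, h₂, mul_assoc]
  obtain ⟨t, m, -, -, -, -, hP⟩ := hS.exists_cycle hne'
  exact not_persistent_of_commute hcomm ((hP 0 (Nat.zero_le _)).mono fun s hs => hs.1)

end Core

/-! ### Persistent `𝓙`-classes are completely simple subsemigroups -/

section JClass

variable {S : Type*} [Semigroup S]

/-- The `𝓙`-class of `z`. -/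
def jClass (z : S) : Set S := {s | JLe (s : WithOne S) z ∧ JLe (z : WithOne S) s}

variable [Finite S] {z : S}

theorem rIdeal_eq_of_mem {a : S} {u : WithOne S} (ha : a ∈ jClass z)
    (h : JLe (z : WithOne S) (a * u)) : rIdeal ((a : WithOne S) * u) = rIdeal (a : WithOne S) :=
  rIdeal_mul_eq (ha.1.trans h)

theorem lIdeal_eq_of_mem {a : S} {u : WithOne S} (ha : a ∈ jClass z)
    (h : JLe (z : WithOne S) (u * a)) : lIdeal (u * (a : WithOne S)) = lIdeal (a : WithOne S) :=
  lIdeal_mul_eq (ha.1.trans h)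

/-- If a Mal'cev sequence stays above `z` without collapsing, then both products of its initial
elements lie above `z`. -/
theorem IsPseudoNilpotent.jle_mul (hS : IsPseudoNilpotent S) {a b : S} {w : ℕ → WithOne S}
    (hne : malcevLam a b w (malcevBound S) ≠ malcevRho a b w (malcevBound S))
    (hz : JLe (z : WithOne S) (malcevLam a b w (malcevBound S) : S)) :
    JLe (z : WithOne S) (a * b : S) ∧ JLe (z : WithOne S) (b * a : S) := by
  obtain ⟨t, m, -, hm, -, -, hP⟩ := hS.exists_cycle hne
  have hzm : JLe (z : WithOne S) (malcevLam a b w m : S) := by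
    rcases hm.lt_or_eq with h | h
    · exact hz.trans (malcev_jle h).1.1
    · rwa [h]
  have hP : Persistent {s : S | s ∈ Subsemigroup.closure {a, b} ∧ JLe (z : WithOne S) s} :=
    (hP 0 (Nat.zero_le _)).mono fun s hs => ⟨hs.1, hzm.trans hs.2⟩
  refine ⟨jle_mul_of_persistent hP, jle_mul_of_persistent ?_⟩
  rwa [Set.pair_comm]

/-- A persistent `𝓙`-class contains two elements that are not `𝓗`-related and all of whose products
remain in the class. -/
theorem IsPseudoNilpotent.exists_pair (hS : IsPseudoNilpotent S) (hz : Persistent (jClass z)) :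
    ∃ x ∈ jClass z, ∃ y ∈ jClass z, JLe (z : WithOne S) (x * x : S) ∧
      JLe (z : WithOne S) (x * y : S) ∧ JLe (z : WithOne S) (y * x : S) ∧
      JLe (z : WithOne S) (y * y : S) ∧
      (lIdeal (x : WithOne S) ≠ lIdeal (y : WithOne S) ∨
        rIdeal (x : WithOne S) ≠ rIdeal (y : WithOne S)) := by
  obtain ⟨x, y, w, -, hmem, hne⟩ := hz (1 + malcevBound S)
  have h0 : malcevLam x y w (malcevBound S) ≠ malcevRho x y w (malcevBound S) :=
    malcev_ne_of_le (by omega) hne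
  obtain ⟨hxy, hyx⟩ := hS.jle_mul h0 (hmem _ (by omega)).1.2
  have hmem1 := (hmem _ le_rfl).1.2
  rw [(malcevPair_add x y w 1 _).1] at hmem1
  rw [(malcevPair_add x y w 1 _).1, (malcevPair_add x y w 1 _).2] at hne
  -- the product `λ_1 * ρ_1` contains `y * y` and `ρ_1 * λ_1` contains `x * x`
  obtain ⟨h₁, h₂⟩ := hS.jle_mul hne hmem1
  have hx : x ∈ jClass z := (hmem 0 (by omega)).1
  have hy : y ∈ jClass z := (hmem 0 (by omega)).2
  have hyy : JLe (z : WithOne S) (y * y : S) := by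
    rw [WithOne.coe_mul, coe_malcevLam_succ, coe_malcevRho_succ] at h₁
    change JLe (z : WithOne S) (x * w 0 * y * (y * w 0 * x)) at h₁
    rw [show (x : WithOne S) * w 0 * y * (y * w 0 * x) = (x * w 0) * ((y * y) * (w 0 * x)) by
      simp only [mul_assoc]] at h₁
    exact h₁.of_mul_left.of_mul_right
  have hxx : JLe (z : WithOne S) (x * x : S) := by
    rw [WithOne.coe_mul, coe_malcevLam_succ, coe_malcevRho_succ] at h₂
    change JLe (z : WithOne S) (y * w 0 * x * (x * w 0 * y)) at h₂
    rw [show (y : WithOne S) * w 0 * x * (x * w 0 * y) = (y * w 0) * ((x * x) * (w 0 * y)) by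
      simp only [mul_assoc]] at h₂
    exact h₂.of_mul_left.of_mul_right
  refine ⟨x, hx, y, hy, hxx, hxy, hyx, hyy, ?_⟩
  by_contra! h
  exact h0 (hS.malcev_eq_of_group h.1 h.2 (hx.1.trans hxx) w)

/-- If all sandwich products of `a` and `b` with parameter `u` stay in the `𝓙`-class, then so does
the Mal'cev sequence with constant parameter `u`. Its terms keep their `𝓡`-classes and exchange
their `𝓛`-classes, so they remain distinct if `a` and `b` are not `𝓗`-related. -/
theorem malcev_const_mem_jClass {a b : S} {u : WithOne S} (ha : a ∈ jClass z) (hb : b ∈ jClass z)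
    (haa : JLe (z : WithOne S) (a * u * a)) (hab : JLe (z : WithOne S) (a * u * b))
    (hba : JLe (z : WithOne S) (b * u * a)) (hbb : JLe (z : WithOne S) (b * u * b))
    (hne : lIdeal (a : WithOne S) ≠ lIdeal (b : WithOne S) ∨
      rIdeal (a : WithOne S) ≠ rIdeal (b : WithOne S)) (n : ℕ) :
    malcevLam a b (fun _ => u) n ∈ jClass z ∧
      malcevLam a b (fun _ => u) n ≠ malcevRho a b (fun _ => u) n := by
  -- congruence: a sandwich product stays in the class if its factors change within `𝓛`, `𝓡`
  have hcongr : ∀ {p q p' q' : WithOne S}, JLe (z : WithOne S) (p' * u * q') →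
      lIdeal p = lIdeal p' → rIdeal q = rIdeal q' → JLe (z : WithOne S) (p * u * q) := by
    intro p q p' q' h hp hq
    have h := h.congr_right hq.symm
    rw [mul_assoc] at h ⊢
    exact h.congr_left hp.symm
  suffices H : ∀ n, ∃ p ∈ jClass z, ∃ q ∈ jClass z, malcevLam a b (fun _ => u) n = p ∧
      malcevRho a b (fun _ => u) n = q ∧
      ((lIdeal (p : WithOne S) = lIdeal (a : WithOne S) ∧
        lIdeal (q : WithOne S) = lIdeal (b : WithOne S)) ∨
       (lIdeal (p : WithOne S) = lIdeal (b : WithOne S) ∧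
        lIdeal (q : WithOne S) = lIdeal (a : WithOne S))) ∧
      rIdeal (p : WithOne S) = rIdeal (a : WithOne S) ∧
      rIdeal (q : WithOne S) = rIdeal (b : WithOne S) by
    obtain ⟨p, hp, q, hq, hp', hq', hl, hr⟩ := H n
    rw [hp', hq']
    refine ⟨hp, ?_⟩
    rintro rfl
    rcases hne with hne | hne
    · rcases hl with hl | hl
      · exact hne (hl.1.symm.trans hl.2)
      · exact hne (hl.2.symm.trans hl.1)
    · exact hne (hr.1.symm.trans hr.2)
  intro n
  induction n with
  | zero => exact ⟨a, ha, b, hb, rfl, rfl, Or.inl ⟨rfl, rfl⟩, rfl, rfl⟩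
  | succ n ih =>
    obtain ⟨p, hp, q, hq, hp', hq', hl, hrp, hrq⟩ := ih
    have hpq : JLe (z : WithOne S) (p * u * q) := by
      rcases hl with hl | hl
      · exact hcongr hab hl.1 hrq
      · exact hcongr hbb hl.1 hrq
    have hqp : JLe (z : WithOne S) (q * u * p) := by
      rcases hl with hl | hl
      · exact hcongr hba hl.2 hrp
      · exact hcongr haa hl.2 hrp
    have hlpq := lIdeal_eq_of_mem hq hpq
    have hlqp := lIdeal_eq_of_mem hp hqp
    have hrpq := rIdeal_eq_of_mem hp (by rwa [mul_assoc] at hpq)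
    have hrqp := rIdeal_eq_of_mem hq (by rwa [mul_assoc] at hqp)
    rw [← mul_assoc] at hrpq hrqp
    rw [← coe_sandwich] at hpq hqp hlpq hlqp hrpq hrqp
    refine ⟨sandwich p u q, ⟨?_, hpq⟩, sandwich q u p, ⟨?_, hqp⟩, ?_, ?_, ?_, ?_, ?_⟩
    · rw [coe_sandwich]; exact (jle_mul_left _ _).trans hq.1
    · rw [coe_sandwich]; exact (jle_mul_left _ _).trans hp.1
    · rw [malcevLam_succ, hp', hq']
    · rw [malcevRho_succ, hp', hq']
    · rw [hlpq, hlqp]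
      exact hl.symm.imp (fun h => ⟨h.2, h.1⟩) (fun h => ⟨h.2, h.1⟩)
    · rw [hrpq, hrp]
    · rw [hrqp, hrq]

/-- If the elements `x`, `y` of different `𝓛`-classes have a common right factor `t` with products
inside the `𝓙`-class, then `x` times any element stays in the class: the non-zero pattern of the
two rows of the sandwich matrix is transported by a parameter `u` to every column. -/
theorem IsPseudoNilpotent.jle_mul_of_lIdeal_ne (hS : IsPseudoNilpotent S) {x y t : S}
    (hx : x ∈ jClass z) (hy : y ∈ jClass z) (ht : t ∈ jClass z)
    (hne : lIdeal (x : WithOne S) ≠ lIdeal (y : WithOne S))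
    (hxt : JLe (z : WithOne S) (x * t : S)) (hyt : JLe (z : WithOne S) (y * t : S))
    {r : S} (hr : r ∈ jClass z) : JLe (z : WithOne S) (x * r : S) := by
  obtain ⟨u, v, htr⟩ := ht.1.trans hr.2
  -- elements `a`, `b` of the `𝓡`-class of `r`, in the `𝓛`-classes of `x` and `y`
  have hpick : ∀ {x : S}, x ∈ jClass z → ∃ a ∈ jClass z,
      lIdeal (a : WithOne S) = lIdeal (x : WithOne S) ∧
        rIdeal (a : WithOne S) = rIdeal (r : WithOne S) := by
    intro x hx
    obtain ⟨p, q, hrx⟩ := hr.1.trans hx.2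
    obtain ⟨a, ha⟩ := WithOne.exists_coe_mul p x
    have haz : JLe (z : WithOne S) a := by
      have h := hr.2
      rw [hrx, ← ha] at h
      exact h.of_mul_right
    have haJ : a ∈ jClass z := ⟨by rw [ha]; exact (jle_mul_left _ _).trans hx.1, haz⟩
    refine ⟨a, haJ, ?_, ?_⟩
    · have := lIdeal_eq_of_mem hx (u := p) (by rwa [← ha])
      rwa [← ha] at this
    · have h := hr.2
      rw [hrx, ← ha] at h
      rw [hrx, ← ha]
      exact (rIdeal_eq_of_mem haJ h).symm
  obtain ⟨a, ha, hal, har⟩ := hpick hx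
  obtain ⟨b, hb, hbl, hbr⟩ := hpick hy
  have hu : ∀ {x a b : S}, JLe (z : WithOne S) (x * t : S) →
      lIdeal (a : WithOne S) = lIdeal (x : WithOne S) →
      rIdeal (b : WithOne S) = rIdeal (r : WithOne S) → JLe (z : WithOne S) (a * u * b) := by
    intro x a b h hl hr
    rw [WithOne.coe_mul, htr, ← mul_assoc, ← mul_assoc] at h
    have h := h.of_mul_right.congr_right hr.symm
    rw [mul_assoc] at h ⊢
    exact h.congr_left hl.symm
  have H := malcev_const_mem_jClass ha hb (hu hxt hal har) (hu hxt hal hbr) (hu hyt hbl har)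
    (hu hyt hbl hbr) (Or.inl (by rwa [hal, hbl])) (malcevBound S)
  have hab := (hS.jle_mul H.2 H.1.2).1
  rw [WithOne.coe_mul] at hab ⊢
  exact (hab.congr_right hbr).congr_left hal

/-- The left-right dual of `IsPseudoNilpotent.jle_mul_of_lIdeal_ne`. -/
theorem IsPseudoNilpotent.jle_mul_of_rIdeal_ne (hS : IsPseudoNilpotent S) {x y t : S}
    (hx : x ∈ jClass z) (hy : y ∈ jClass z) (ht : t ∈ jClass z)
    (hne : rIdeal (x : WithOne S) ≠ rIdeal (y : WithOne S))
    (hxt : JLe (z : WithOne S) (t * x : S)) (hyt : JLe (z : WithOne S) (t * y : S))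
    {r : S} (hr : r ∈ jClass z) : JLe (z : WithOne S) (r * x : S) := by
  obtain ⟨v, u, htr⟩ := ht.1.trans hr.2
  have hpick : ∀ {x : S}, x ∈ jClass z → ∃ a ∈ jClass z,
      rIdeal (a : WithOne S) = rIdeal (x : WithOne S) ∧
        lIdeal (a : WithOne S) = lIdeal (r : WithOne S) := by
    intro x hx
    obtain ⟨p, q, hrx⟩ := hr.1.trans hx.2
    obtain ⟨a, ha⟩ := WithOne.exists_coe_mul' q x
    rw [mul_assoc, ← ha] at hrx
    have haz : JLe (z : WithOne S) a := by
      have h := hr.2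
      rw [hrx] at h
      exact h.of_mul_left
    have haJ : a ∈ jClass z := ⟨by rw [ha]; exact (jle_mul_right _ _).trans hx.1, haz⟩
    refine ⟨a, haJ, ?_, ?_⟩
    · have := rIdeal_eq_of_mem hx (u := q) (by rwa [← ha])
      rwa [← ha] at this
    · have h := hr.2
      rw [hrx] at h
      rw [hrx]
      exact (lIdeal_eq_of_mem haJ h).symm
  obtain ⟨a, ha, har, hal⟩ := hpick hx
  obtain ⟨b, hb, hbr, hbl⟩ := hpick hy
  have hu : ∀ {x a b : S}, JLe (z : WithOne S) (t * x : S) →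
      rIdeal (a : WithOne S) = rIdeal (x : WithOne S) →
      lIdeal (b : WithOne S) = lIdeal (r : WithOne S) → JLe (z : WithOne S) (b * u * a) := by
    intro x a b h hr hl
    rw [WithOne.coe_mul, htr, mul_assoc, mul_assoc] at h
    have h := h.of_mul_left.congr_left hl.symm
    rw [← mul_assoc] at h
    exact h.congr_right hr.symm
  have H := malcev_const_mem_jClass ha hb (hu hxt har hal) (hu hyt hbr hal) (hu hxt har hbl)
    (hu hyt hbr hbl) (Or.inr (by rwa [har, hbr])) (malcevBound S)
  have hba := (hS.jle_mul H.2 H.1.2).2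
  rw [WithOne.coe_mul] at hba ⊢
  exact (hba.congr_right har).congr_left hbl

/-- A persistent `𝓙`-class of a pseudo-nilpotent finite semigroup is closed under
multiplication. -/
theorem IsPseudoNilpotent.jle_mul_of_mem (hS : IsPseudoNilpotent S) (hz : Persistent (jClass z))
    {a b : S} (ha : a ∈ jClass z) (hb : b ∈ jClass z) : JLe (z : WithOne S) (a * b : S) := by
  obtain ⟨x, hx, y, hy, hxx, hxy, hyx, hyy, hne | hne⟩ := hS.exists_pair hz
  · have hrow : ∀ {r : S}, r ∈ jClass z → JLe (z : WithOne S) (x * r : S) :=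
      hS.jle_mul_of_lIdeal_ne hx hy hx hne hxx hyx
    by_cases hl : lIdeal (a : WithOne S) = lIdeal (x : WithOne S)
    · have := hrow hb
      rw [WithOne.coe_mul] at this ⊢
      exact this.congr_left hl.symm
    · obtain ⟨p, q, hpq⟩ := hx.1.trans ha.2
      obtain ⟨t, ht⟩ := WithOne.exists_coe_mul q x
      have hat : JLe (z : WithOne S) (a * t : S) := by
        have h := hxx
        rw [WithOne.coe_mul] at h
        nth_rewrite 1 [hpq] at h
        rw [mul_assoc, ← ht, mul_assoc] at h
        rw [WithOne.coe_mul]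
        exact h.of_mul_left
      have htJ : t ∈ jClass z := ⟨by rw [ht]; exact (jle_mul_left _ _).trans hx.1, by
        rw [WithOne.coe_mul] at hat; exact hat.of_mul_left⟩
      exact hS.jle_mul_of_lIdeal_ne ha hx htJ hl hat (hrow htJ) hb
  · have hcol : ∀ {r : S}, r ∈ jClass z → JLe (z : WithOne S) (r * x : S) :=
      hS.jle_mul_of_rIdeal_ne hx hy hx hne hxx hxy
    by_cases hl : rIdeal (b : WithOne S) = rIdeal (x : WithOne S)
    · have := hcol ha
      rw [WithOne.coe_mul] at this ⊢
      exact this.congr_right hl.symm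
    · obtain ⟨p, q, hpq⟩ := hx.1.trans hb.2
      obtain ⟨t, ht⟩ := WithOne.exists_coe_mul' p x
      have htb : JLe (z : WithOne S) (t * b : S) := by
        have h := hxx
        rw [WithOne.coe_mul] at h
        nth_rewrite 2 [hpq] at h
        rw [← mul_assoc, ← mul_assoc, ← ht] at h
        rw [WithOne.coe_mul]
        exact h.of_mul_right
      have htJ : t ∈ jClass z := ⟨by rw [ht]; exact (jle_mul_right _ _).trans hx.1, by
        rw [WithOne.coe_mul] at htb; exact htb.of_mul_right⟩
      exact hS.jle_mul_of_rIdeal_ne hb hx htJ hl htb (hcol htJ) ha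

/-- The elements above a persistent `𝓙`-class act on it from both sides. -/
theorem IsPseudoNilpotent.mul_mem_jClass (hS : IsPseudoNilpotent S) (hz : Persistent (jClass z))
    {s a : S} (hs : JLe (z : WithOne S) s) (ha : a ∈ jClass z) :
    s * a ∈ jClass z ∧ a * s ∈ jClass z := by
  have hzz : z ∈ jClass z := ⟨JLe.refl _, JLe.refl _⟩
  obtain ⟨p, q, hpq⟩ := hs
  obtain ⟨t, ht⟩ := WithOne.exists_coe_mul q z
  have hst : JLe (z : WithOne S) (s * t : S) := by
    have h := hS.jle_mul_of_mem hz hzz hzz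
    rw [WithOne.coe_mul] at h
    nth_rewrite 2 [hpq] at h
    rw [mul_assoc, ← ht, mul_assoc] at h
    rw [WithOne.coe_mul]
    exact h.of_mul_left
  have htz : JLe (t : WithOne S) z := by rw [ht]; exact jle_mul_left _ _
  have hstJ : s * t ∈ jClass z :=
    ⟨by rw [WithOne.coe_mul]; exact (jle_mul_left _ _).trans htz, hst⟩
  have hright : ∀ {a : S}, a ∈ jClass z → a * s ∈ jClass z := by
    intro a ha
    have h := hS.jle_mul_of_mem hz ha hstJ
    rw [← mul_assoc, WithOne.coe_mul] at h
    exact ⟨by rw [WithOne.coe_mul]; exact (jle_mul_right _ _).trans ha.1, h.of_mul_right⟩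
  refine ⟨⟨by rw [WithOne.coe_mul]; exact (jle_mul_left _ _).trans ha.1, ?_⟩, hright ha⟩
  have h := hS.jle_mul_of_mem hz (hright hzz) ha
  rw [mul_assoc, WithOne.coe_mul] at h
  exact h.of_mul_left

/-- Elements of a persistent `𝓙`-class that are not `𝓗`-related generate a Mal'cev sequence (with
all parameters `1`) that never collapses. -/
theorem IsPseudoNilpotent.malcev_ne_of_mem (hS : IsPseudoNilpotent S) (hz : Persistent (jClass z))
    {a b : S} (ha : a ∈ jClass z) (hb : b ∈ jClass z)
    (hne : lIdeal (a : WithOne S) ≠ lIdeal (b : WithOne S) ∨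
      rIdeal (a : WithOne S) ≠ rIdeal (b : WithOne S)) (n : ℕ) :
    malcevLam a b (fun _ => 1) n ≠ malcevRho a b (fun _ => 1) n := by
  have h : ∀ {a b : S}, a ∈ jClass z → b ∈ jClass z → JLe (z : WithOne S) (a * 1 * b) := by
    intro a b ha hb
    rw [mul_one, ← WithOne.coe_mul]
    exact hS.jle_mul_of_mem hz ha hb
  exact (malcev_const_mem_jClass ha hb (h ha ha) (h ha hb) (h hb ha) (h hb hb) hne n).2

/-- Every element above a persistent `𝓙`-class is adjacent to an element of the class. -/
theorem IsPseudoNilpotent.exists_adj (hS : IsPseudoNilpotent S) (hz : Persistent (jClass z))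
    {s : S} (hs : JLe (z : WithOne S) s) :
    ∃ x ∈ jClass z, (upperNonNilpotentGraph S).Adj s x := by
  have hzz : z ∈ jClass z := ⟨JLe.refl _, JLe.refl _⟩
  -- a first step with parameter `z` moves the pair `(s, x)` into the `𝓙`-class
  have key : ∀ x ∈ jClass z, (lIdeal (x : WithOne S) ≠ lIdeal ((z * s : S) : WithOne S) ∨
      rIdeal ((s * z : S) : WithOne S) ≠ rIdeal (x : WithOne S)) →
      (upperNonNilpotentGraph S).Adj s x := by
    intro x hx hne
    have hsz := (hS.mul_mem_jClass hz hs hzz).1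
    have hzs := (hS.mul_mem_jClass hz hs hzz).2
    have h₁ : s * z * x ∈ jClass z := (hS.mul_mem_jClass hz hsz.2 hx).1
    have h₂ : x * z * s ∈ jClass z := by
      rw [mul_assoc]; exact (hS.mul_mem_jClass hz hx.2 hzs).1
    have hne' : lIdeal ((s * z * x : S) : WithOne S) ≠ lIdeal ((x * z * s : S) : WithOne S) ∨
        rIdeal ((s * z * x : S) : WithOne S) ≠ rIdeal ((x * z * s : S) : WithOne S) := by
      have e₁ := h₁.2
      have e₂ := h₂.2
      rw [mul_assoc, WithOne.coe_mul] at e₂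
      rw [WithOne.coe_mul] at e₁
      rw [mul_assoc x, WithOne.coe_mul, WithOne.coe_mul x, lIdeal_eq_of_mem hx e₁,
        lIdeal_eq_of_mem hzs e₂, rIdeal_eq_of_mem hsz e₁, rIdeal_eq_of_mem hx e₂]
      exact hne
    let w : ℕ → WithOne S := fun n => if n = 0 then (z : WithOne S) else 1
    refine hS.adj (w := w) (malcev_ne_of_le (show malcevBound S ≤ 1 + malcevBound S by omega) ?_)
    rw [(malcevPair_add s x w 1 _).1, (malcevPair_add s x w 1 _).2]
    have hw : (fun k => w (1 + k)) = fun _ => 1 := by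
      funext k
      exact if_neg (by omega)
    rw [hw]
    exact hS.malcev_ne_of_mem hz h₁ h₂ hne' _
  obtain ⟨x, hx, y, hy, -, -, -, -, hne | hne⟩ := hS.exists_pair hz
  · by_cases h : lIdeal (x : WithOne S) = lIdeal ((z * s : S) : WithOne S)
    · exact ⟨y, hy, key y hy (Or.inl fun h' => hne (h.trans h'.symm))⟩
    · exact ⟨x, hx, key x hx (Or.inl h)⟩
  · by_cases h : rIdeal ((s * z : S) : WithOne S) = rIdeal (x : WithOne S)
    · exact ⟨y, hy, key y hy (Or.inr fun h' => hne (h.symm.trans h'))⟩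
    · exact ⟨x, hx, key x hx (Or.inr h)⟩

/-- All elements above a persistent `𝓙`-class lie in one connected component. -/
theorem IsPseudoNilpotent.reachable (hS : IsPseudoNilpotent S) (hz : Persistent (jClass z))
    {s t : S} (hs : JLe (z : WithOne S) s) (ht : JLe (z : WithOne S) t) :
    (upperNonNilpotentGraph S).Reachable s t := by
  have hadj : ∀ {a b : S}, a ∈ jClass z → b ∈ jClass z →
      (lIdeal (a : WithOne S) ≠ lIdeal (b : WithOne S) ∨
        rIdeal (a : WithOne S) ≠ rIdeal (b : WithOne S)) →
      (upperNonNilpotentGraph S).Adj a b := fun ha hb hne =>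
    hS.adj (hS.malcev_ne_of_mem hz ha hb hne _)
  have hJ : ∀ {a b : S}, a ∈ jClass z → b ∈ jClass z →
      (upperNonNilpotentGraph S).Reachable a b := by
    intro a b ha hb
    by_cases hab : lIdeal (a : WithOne S) ≠ lIdeal (b : WithOne S) ∨
        rIdeal (a : WithOne S) ≠ rIdeal (b : WithOne S)
    · exact (hadj ha hb hab).reachable
    · -- `𝓗`-related elements have a common neighbour outside their `𝓗`-class
      push Not at hab
      obtain ⟨x, hx, y, hy, -, -, -, -, hne⟩ := hS.exists_pair hz
      obtain ⟨c, hc, hac⟩ : ∃ c ∈ jClass z, lIdeal (a : WithOne S) ≠ lIdeal (c : WithOne S) ∨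
          rIdeal (a : WithOne S) ≠ rIdeal (c : WithOne S) := by
        by_contra! h
        rcases hne with hne | hne
        · exact hne ((h x hx).1.symm.trans (h y hy).1)
        · exact hne ((h x hx).2.symm.trans (h y hy).2)
      have hbc : lIdeal (b : WithOne S) ≠ lIdeal (c : WithOne S) ∨
          rIdeal (b : WithOne S) ≠ rIdeal (c : WithOne S) := by
        rwa [← hab.1, ← hab.2]
      exact (hadj ha hc hac).reachable.trans (hadj hb hc hbc).reachable.symm
  obtain ⟨x, hx, hsx⟩ := hS.exists_adj hz hs
  obtain ⟨y, hy, hty⟩ := hS.exists_adj hz ht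
  exact (hsx.reachable.trans (hJ hx hy)).trans hty.reachable.symm

/-- A persistent subsemigroup contains an element `z` such that its trace on the `𝓙`-class of `z`
is persistent. -/
theorem IsPseudoNilpotent.exists_persistent_jClass (hS : IsPseudoNilpotent S) {B : Subsemigroup S}
    (hB : Persistent (B : Set S)) : ∃ z ∈ B, Persistent ((B : Set S) ∩ jClass z) := by
  obtain ⟨x, y, w, -, hmem, hne⟩ := hB (malcevBound S)
  obtain ⟨t, m, htm, hm, h₁, h₂, hP⟩ := hS.exists_cycle hne
  refine ⟨malcevLam x y w t, (hmem t (by omega)).1, (hP t htm.le).mono ?_⟩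
  rintro s ⟨hs, hzs⟩
  rw [← h₁] at hzs
  have hρ : JLe ((malcevRho x y w t : S) : WithOne S) (malcevLam x y w t : S) := by
    have := (malcev_jle (x := x) (y := y) (w := w) htm).2.1
    rwa [← h₂] at this
  refine ⟨(Subsemigroup.closure_le.2 ?_ : _ ≤ B) hs, ?_, hzs⟩
  · rintro _ (rfl | rfl)
    exacts [(hmem t (by omega)).1, (hmem t (by omega)).2]
  · have hle : Subsemigroup.closure {malcevLam x y w t, malcevRho x y w t} ≤
        (isSemigroupIdeal_jle ((malcevLam x y w t : S) : WithOne S)).toSubsemigroup :=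
      Subsemigroup.closure_le.2 (by
        rintro _ (rfl | rfl)
        exacts [JLe.refl _, hρ])
    exact hle hs

/-- Below any two adjacent elements there is a persistent `𝓙`-class. -/
theorem IsPseudoNilpotent.exists_persistent_of_adj (hS : IsPseudoNilpotent S) {a b : S}
    (hab : (upperNonNilpotentGraph S).Adj a b) :
    ∃ z : S, Persistent (jClass z) ∧ JLe (z : WithOne S) a ∧ JLe (z : WithOne S) b := by
  obtain ⟨z, -, hP⟩ := hS.exists_persistent_jClass ((not_isMalcevNilpotent_iff _).1 hab.2)
  have key : ∀ a b : S, Persistent ((Subsemigroup.closure {a, b} : Set S) ∩ jClass z) →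
      JLe (z : WithOne S) a := by
    intro a b hP
    by_contra hza
    have hpow : ∀ p ∈ Subsemigroup.closure {a, b}, JLe (z : WithOne S) p →
        p ∈ Subsemigroup.closure {b} := by
      intro p hp hz
      induction hp using Subsemigroup.closure_induction with
      | mem p hp =>
        rcases hp with rfl | rfl
        · exact absurd hz hza
        · exact Subsemigroup.subset_closure rfl
      | mul p q _ _ h₁ h₂ =>
        rw [WithOne.coe_mul] at hz
        exact mul_mem (h₁ hz.of_mul_right) (h₂ hz.of_mul_left)
    exact not_persistent_of_commute (fun p hp q hq => mul_comm_of_mem_closure_singleton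
      (hpow p hp.1 hp.2.2) (hpow q hq.1 hq.2.2)) hP
  exact ⟨z, hP.mono Set.inter_subset_right, key a b hP, key b a (by rwa [Set.pair_comm])⟩

end JClass

/-! ### The layers of a principal series -/

namespace PrincipalSeries

variable {S : Type*} [Semigroup S] (P : PrincipalSeries S)

theorem ideal_antitone {i j : Fin (P.length + 1)} (h : i ≤ j) : P.ideal j ⊆ P.ideal i := by
  have : Antitone P.ideal := Fin.antitone_iff_succ_le.2 fun i => (P.ssubset i).subset
  exact this h

theorem exists_mem_layer (s : S) : ∃ i, s ∈ P.layer i := by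
  by_contra! h
  have hall : ∀ i : Fin (P.length + 1), s ∈ P.ideal i := by
    intro i
    induction i using Fin.induction with
    | zero => rw [P.first]; trivial
    | succ i ih => exact not_not.1 fun hn => h i ⟨ih, hn⟩
  have := hall (Fin.last _)
  rwa [P.last] at this

variable {P}

theorem le_of_jle {i j : Fin P.length} {a b : S} (ha : a ∈ P.layer i) (hb : b ∈ P.layer j)
    (h : JLe (a : WithOne S) b) : j ≤ i := by
  by_contra hij
  exact ha.2 (P.ideal_antitone (Fin.succ_le_castSucc_iff.2 (not_le.1 hij))
    ((P.isIdeal _).mem_of_jle h hb.1))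

theorem jle_of_mem_layer {i : Fin P.length} {a b : S} (ha : a ∈ P.layer i) (hb : b ∈ P.layer i) :
    JLe (a : WithOne S) b := by
  -- otherwise the ideal generated by `b` and `S_{i+1}` lies strictly between `S_{i+1}` and `S_i`
  by_contra hab
  refine P.maximal i (P.ideal i.succ ∪ {s : S | JLe (s : WithOne S) b}) ?_ ⟨?_, ?_⟩
  · rintro c (hc | hc) s
    · exact ⟨Or.inl (P.isIdeal _ c hc s).1, Or.inl (P.isIdeal _ c hc s).2⟩
    · exact ⟨Or.inr (isSemigroupIdeal_jle _ c hc s).1, Or.inr (isSemigroupIdeal_jle _ c hc s).2⟩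
  · exact ⟨Set.subset_union_left, fun h => hb.2 (h (Or.inr (JLe.refl _)))⟩
  · refine ⟨Set.union_subset (P.ssubset i).subset fun s hs => (P.isIdeal _).mem_of_jle hs hb.1,
      fun h => ?_⟩
    rcases h ha.1 with h | h
    · exact ha.2 h
    · exact hab h

/-- The layers of a principal series are the `𝓙`-classes. -/
theorem layer_eq_jClass {i : Fin P.length} {z : S} (hz : z ∈ P.layer i) :
    P.layer i = jClass z := by
  ext s
  refine ⟨fun hs => ⟨jle_of_mem_layer hs hz, jle_of_mem_layer hz hs⟩, fun hs => ?_⟩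
  obtain ⟨j, hj⟩ := P.exists_mem_layer s
  obtain rfl : i = j := le_antisymm (le_of_jle hj hz hs.1) (le_of_jle hz hj hs.2)
  exact hj

/-- A principal factor is not nilpotent if and only if the corresponding layer is persistent. -/
theorem not_isMalcevNilpotent_factor_iff (i : Fin P.length) :
    ¬ IsMalcevNilpotent (P.Factor i) ↔ Persistent (P.layer i) := by
  have hI := (P.isIdeal i.succ).preimage (P.isIdeal i.castSucc).toSubsemigroup
  constructor
  · intro h
    have hP := persistent_of_not_isMalcevNilpotent hI (MulHom.id _) (fun _ _ h => h) h
    refine (hP.image (MulMemClass.subtype _) Subtype.val_injective).mono ?_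
    rintro _ ⟨s, hs, rfl⟩
    exact ⟨s.2, hs.1⟩
  · intro h
    refine h.not_isMalcevNilpotent (MulMemClass.subtype (P.isIdeal i.castSucc).toSubsemigroup)
      (fun s hs => ⟨⟨s, hs.1⟩, rfl⟩) ⟨ReesQuotient.mk _ hI, fun _ _ => rfl⟩ ?_
    intro u v hu _ huv
    rcases (Con.eq _).1 huv with h | h
    · exact congrArg Subtype.val h
    · exact absurd h.1 hu.2

theorem exists_jle_of_mem_F {i : Fin P.length} {s : S} (hs : s ∈ P.F i) :
    ∃ z ∈ P.layer i, JLe (z : WithOne S) s := by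
  obtain ⟨-, j, hj, h | h⟩ := hs
  · exact ⟨s * j, ⟨(P.isIdeal _ j hj.1 s).1, h⟩, by
      rw [WithOne.coe_mul]; exact jle_mul_right _ _⟩
  · exact ⟨j * s, ⟨(P.isIdeal _ j hj.1 s).2, h⟩, by
      rw [WithOne.coe_mul]; exact jle_mul_left _ _⟩

variable [Finite S]

theorem mem_F_of_jle (hS : IsPseudoNilpotent S) {i : Fin P.length} {z s : S} (hz : z ∈ P.layer i)
    (hP : Persistent (P.layer i)) (hs : JLe (z : WithOne S) s) (hsi : s ∉ P.layer i) :
    s ∈ P.F i := by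
  have hmul := (hS.mul_mem_jClass (layer_eq_jClass hz ▸ hP) hs ⟨JLe.refl _, JLe.refl _⟩).1
  rw [← layer_eq_jClass hz] at hmul
  refine ⟨fun h => hsi ⟨h, fun h' => hz.2 ((P.isIdeal _).mem_of_jle hs h')⟩, z, hz,
    Or.inl hmul.2⟩

/-- The stem of a persistent layer consists of the elements lying `𝓙`-above the layer. -/
theorem mem_stem_iff (hS : IsPseudoNilpotent S) {i : Fin P.length} {z : S} (hz : z ∈ P.layer i)
    (hP : Persistent (P.layer i)) {s : S} : s ∈ P.stem i ↔ JLe (z : WithOne S) s := by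
  constructor
  · rintro ⟨j, -, hj, hs⟩
    rcases hj hs with h | h
    · obtain ⟨y, hy, hys⟩ := exists_jle_of_mem_F h
      exact (jle_of_mem_layer hz hy).trans hys
    · exact jle_of_mem_layer hz h
  · intro hzs
    obtain ⟨j, hj⟩ := P.exists_mem_layer s
    refine ⟨j, le_of_jle hz hj hzs, fun t ht => ?_, hj⟩
    by_cases hti : t ∈ P.layer i
    · exact Or.inr hti
    · exact Or.inl (mem_F_of_jle hS hz hP (hzs.trans (jle_of_mem_layer hj ht)) hti)

/-- Below two adjacent elements there is a persistent layer. -/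
theorem exists_layer_of_adj (hS : IsPseudoNilpotent S) {a b : S}
    (hab : (upperNonNilpotentGraph S).Adj a b) :
    ∃ i, ∃ z ∈ P.layer i, Persistent (P.layer i) ∧ JLe (z : WithOne S) a ∧
      JLe (z : WithOne S) b := by
  obtain ⟨z, hz, hza, hzb⟩ := hS.exists_persistent_of_adj hab
  obtain ⟨i, hi⟩ := P.exists_mem_layer z
  exact ⟨i, z, hi, by rwa [layer_eq_jClass hi], hza, hzb⟩

/-- Among the persistent layers below a given element, the one with the largest index is a root:
an edge from it into the next term of the series would have a persistent layer further down. -/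
theorem exists_root (hS : IsPseudoNilpotent S) {i : Fin P.length} {z s : S} (hz : z ∈ P.layer i)
    (hP : Persistent (P.layer i)) (hs : JLe (z : WithOne S) s) :
    ∃ j, P.IsRoot j ∧ ∃ y ∈ P.layer j, Persistent (P.layer j) ∧ JLe (y : WithOne S) s := by
  let A : Set (Fin P.length) :=
    {j | ∃ y ∈ P.layer j, Persistent (P.layer j) ∧ JLe (y : WithOne S) s}
  obtain ⟨j, ⟨y, hy, hPj, hys⟩, hmax⟩ :=
    (Set.toFinite A).exists_maximal ⟨i, z, hz, hP, hs⟩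
  refine ⟨j, ⟨(not_isMalcevNilpotent_factor_iff j).2 hPj, fun a ha b hb hab => ?_⟩, y, hy, hPj, hys⟩
  obtain ⟨k, x, hx, hPk, hxa, hxb⟩ := exists_layer_of_adj (P := P) hS hab
  have hkj : k ≤ j := by
    have hk : k ∈ A := ⟨x, hx, hPk, (hxa.trans (jle_of_mem_layer ha hy)).trans hys⟩
    exact (le_total k j).elim id fun h => hmax hk h
  exact hx.2 (P.ideal_antitone (Fin.succ_le_succ_iff.2 hkj) ((P.isIdeal _).mem_of_jle hxb hb))

/-- `K` consists of the elements that are not above any persistent layer. -/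
theorem mem_K_iff (hS : IsPseudoNilpotent S) {s : S} :
    s ∈ P.K ↔ ∀ i, ∀ z ∈ P.layer i, Persistent (P.layer i) → ¬ JLe (z : WithOne S) s := by
  constructor
  · rintro ⟨k, ⟨hroot, hnil⟩, hs⟩ i z hz hP hzs
    -- every persistent layer below `s` is the layer of `s` itself
    have hunique : ∀ i, ∀ z ∈ P.layer i, Persistent (P.layer i) → JLe (z : WithOne S) s →
        i = k := by
      intro i z hz hP hzs
      by_contra hik
      refine (not_isMalcevNilpotent_factor_iff i).2 hP (hnil i fun t ht => ?_)
      refine mem_F_of_jle hS hz hP (hzs.trans (jle_of_mem_layer hs ht)) fun hti => hik ?_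
      exact le_antisymm (le_of_jle ht hti (JLe.refl _)) (le_of_jle hti ht (JLe.refl _))
    obtain ⟨j, hj, y, hy, hPj, hys⟩ := exists_root hS hz hP hzs
    exact hroot (hunique j y hy hPj hys ▸ hj)
  · intro h
    obtain ⟨k, hk⟩ := P.exists_mem_layer s
    refine ⟨k, ⟨fun hroot => ?_, fun j hj => ?_⟩, hk⟩
    · exact h k s hk ((not_isMalcevNilpotent_factor_iff k).1 hroot.1) (JLe.refl _)
    · by_contra hn
      obtain ⟨z, hz, hzs⟩ := exists_jle_of_mem_F (hj hk)
      exact h j z hz ((not_isMalcevNilpotent_factor_iff j).1 hn) hzs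

theorem isSemigroupIdeal_K (hS : IsPseudoNilpotent S) : IsSemigroupIdeal P.K := by
  intro a ha s
  simp only [mem_K_iff hS, WithOne.coe_mul] at ha ⊢
  exact ⟨fun i z hz hP h => ha i z hz hP h.of_mul_left,
    fun i z hz hP h => ha i z hz hP h.of_mul_right⟩

theorem isMalcevNilpotent_K (hS : IsPseudoNilpotent S) (hK : IsSemigroupIdeal P.K) :
    IsMalcevNilpotent hK.toSubsemigroup := by
  by_contra hn
  obtain ⟨z, hzK, hP⟩ := hS.exists_persistent_jClass ((not_isMalcevNilpotent_iff _).1 hn)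
  obtain ⟨i, hi⟩ := P.exists_mem_layer z
  refine (mem_K_iff hS).1 hzK i z hi ?_ (JLe.refl _)
  rw [layer_eq_jClass hi]
  exact hP.mono Set.inter_subset_right

theorem subset_K_of_isMalcevNilpotent (hS : IsPseudoNilpotent S) {I : Set S}
    (hI : IsSemigroupIdeal I) (hn : IsMalcevNilpotent hI.toSubsemigroup) : I ⊆ P.K := by
  intro s hs
  rw [mem_K_iff hS]
  intro i z hz hP hzs
  refine (not_isMalcevNilpotent_iff hI.toSubsemigroup).2 (hP.mono fun t ht => ?_) hn
  exact hI.mem_of_jle ((jle_of_mem_layer ht hz).trans hzs) hs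

/-! ### Connected components -/

/-- An element outside `K` lies in the stem of a root. -/
theorem exists_stem_of_notMem_K (hS : IsPseudoNilpotent S) {s : S} (hs : s ∉ P.K) :
    ∃ i, P.IsRoot i ∧ ∃ z ∈ P.layer i, Persistent (P.layer i) ∧ JLe (z : WithOne S) s := by
  rw [mem_K_iff hS] at hs
  push Not at hs
  obtain ⟨i, z, hz, hP, hzs⟩ := hs
  exact exists_root hS hz hP hzs

theorem reachable_of_jle (hS : IsPseudoNilpotent S) {i : Fin P.length} {z s t : S}
    (hz : z ∈ P.layer i) (hP : Persistent (P.layer i)) (hs : JLe (z : WithOne S) s)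
    (ht : JLe (z : WithOne S) t) : (upperNonNilpotentGraph S).Reachable s t :=
  hS.reachable (by rwa [layer_eq_jClass hz] at hP) hs ht

/-- An element lies outside `K` if and only if it has a neighbour. -/
theorem notMem_K_iff_exists_adj (hS : IsPseudoNilpotent S) {s : S} :
    s ∉ P.K ↔ ∃ t, (upperNonNilpotentGraph S).Adj s t := by
  constructor
  · intro hs
    obtain ⟨i, -, z, hz, hP, hzs⟩ := exists_stem_of_notMem_K hS hs
    rw [layer_eq_jClass hz] at hP
    obtain ⟨t, -, ht⟩ := hS.exists_adj hP hzs
    exact ⟨t, ht⟩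
  · rintro ⟨t, ht⟩ hs
    obtain ⟨i, z, hz, hP, hzs, -⟩ := exists_layer_of_adj (P := P) hS ht
    exact (mem_K_iff hS).1 hs i z hz hP hzs

theorem notMem_K_of_mem_supp (hS : IsPseudoNilpotent S)
    {C : (upperNonNilpotentGraph S).ConnectedComponent} (hC : C.supp.Nontrivial) {s : S}
    (hs : s ∈ C.supp) : s ∉ P.K := by
  obtain ⟨t, ht, hne⟩ := hC.exists_ne s
  have hreach : (upperNonNilpotentGraph S).Reachable s t :=
    SimpleGraph.ConnectedComponent.exact (hs.trans ht.symm)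
  obtain ⟨p⟩ := hreach
  cases p with
  | nil => exact absurd rfl hne
  | cons h _ => exact (notMem_K_iff_exists_adj hS).2 ⟨_, h⟩

theorem nontrivial_supp_of_notMem_K (hS : IsPseudoNilpotent S) {s : S} (hs : s ∉ P.K) :
    ((upperNonNilpotentGraph S).connectedComponentMk s).supp.Nontrivial := by
  obtain ⟨t, ht⟩ := (notMem_K_iff_exists_adj hS).1 hs
  exact ⟨s, rfl, t, SimpleGraph.ConnectedComponent.sound ht.symm.reachable, ht.ne⟩

/-- A product outside `K` lies in the component of each of its factors. -/
theorem component_mul_eq (hS : IsPseudoNilpotent S) {a b : S} (hab : a * b ∉ P.K) :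
    (upperNonNilpotentGraph S).connectedComponentMk (a * b) =
        (upperNonNilpotentGraph S).connectedComponentMk a ∧
      (upperNonNilpotentGraph S).connectedComponentMk (a * b) =
        (upperNonNilpotentGraph S).connectedComponentMk b := by
  obtain ⟨i, -, z, hz, hP, hzs⟩ := exists_stem_of_notMem_K hS hab
  have hzs' := hzs
  rw [WithOne.coe_mul] at hzs'
  exact ⟨SimpleGraph.ConnectedComponent.sound (reachable_of_jle hS hz hP hzs hzs'.of_mul_right),
    SimpleGraph.ConnectedComponent.sound (reachable_of_jle hS hz hP hzs hzs'.of_mul_left)⟩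

theorem supp_eq_iUnion_stem (hS : IsPseudoNilpotent S)
    (C : (upperNonNilpotentGraph S).ConnectedComponent) (hC : C.supp.Nontrivial) :
    ∃ R : Set (Fin P.length), (∀ i ∈ R, P.IsRoot i) ∧ C.supp = ⋃ i ∈ R, P.stem i := by
  refine ⟨{i | P.IsRoot i ∧ P.stem i ⊆ C.supp}, fun i hi => hi.1, Set.Subset.antisymm ?_ ?_⟩
  · intro s hs
    obtain ⟨i, hi, z, hz, hP, hzs⟩ := exists_stem_of_notMem_K hS (notMem_K_of_mem_supp hS hC hs)
    refine Set.mem_iUnion₂.2 ⟨i, ⟨hi, fun t ht => ?_⟩, (mem_stem_iff hS hz hP).2 hzs⟩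
    have ht' := (mem_stem_iff hS hz hP).1 ht
    exact (SimpleGraph.ConnectedComponent.sound (reachable_of_jle hS hz hP ht' hzs)).trans hs
  · exact Set.iUnion₂_subset fun i hi => hi.2

theorem exists_subsemigroup_supp_union_K (hS : IsPseudoNilpotent S)
    (C : (upperNonNilpotentGraph S).ConnectedComponent) :
    ∃ T : Subsemigroup S, (T : Set S) = C.supp ∪ P.K := by
  refine ⟨⟨C.supp ∪ P.K, fun {a b} ha hb => ?_⟩, rfl⟩
  by_cases hab : a * b ∈ P.K
  · exact Or.inr hab
  rcases ha with ha | ha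
  · exact Or.inl ((component_mul_eq hS hab).1.trans ha)
  · exact absurd (isSemigroupIdeal_K hS a ha b).2 hab

end PrincipalSeries

theorem mainTheorem2 {S : Type*} [Semigroup S] [Finite S] (hS : IsPseudoNilpotent S)
    (P : PrincipalSeries S) :
    -- every connected component with more than one element is a union of stems
    (∀ C : (upperNonNilpotentGraph S).ConnectedComponent, C.supp.Nontrivial →
      ∃ R : Set (Fin P.length), (∀ i ∈ R, P.IsRoot i) ∧ C.supp = ⋃ i ∈ R, P.stem i) ∧
    -- for every connected component `C`, the set `C ∪ K` is a semigroup
    (∀ C : (upperNonNilpotentGraph S).ConnectedComponent,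
      ∃ T : Subsemigroup S, (T : Set S) = C.supp ∪ P.K) ∧
    -- `K` is the largest nilpotent ideal
    ∃ hK : IsSemigroupIdeal P.K, IsMalcevNilpotent hK.toSubsemigroup ∧
      (∀ (I : Set S) (hI : IsSemigroupIdeal I),
        IsMalcevNilpotent hI.toSubsemigroup → I ⊆ P.K) ∧
      -- `S / K` is the `0`-disjoint union of the `C^θ` over the components `C` with more than
      -- one element (it is just the zero if there are none); `adjoinTheta P.K hK ∅` is `{θ}`
      (∀ C : (upperNonNilpotentGraph S).ConnectedComponent, C.supp.Nontrivial →
        Disjoint C.supp P.K ∧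
        ∃ T : Subsemigroup (ReesQuotient P.K hK),
          (T : Set (ReesQuotient P.K hK)) = adjoinTheta P.K hK C.supp) ∧
      (Set.univ : Set (ReesQuotient P.K hK)) = adjoinTheta P.K hK ∅ ∪
        ⋃ C ∈ {C : (upperNonNilpotentGraph S).ConnectedComponent | C.supp.Nontrivial},
          adjoinTheta P.K hK C.supp ∧
      (∀ C D : (upperNonNilpotentGraph S).ConnectedComponent,
        C.supp.Nontrivial → D.supp.Nontrivial → C ≠ D →
        adjoinTheta P.K hK C.supp ∩ adjoinTheta P.K hK D.supp = adjoinTheta P.K hK ∅ ∧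
        ∀ a ∈ adjoinTheta P.K hK C.supp, ∀ b ∈ adjoinTheta P.K hK D.supp,
          a * b ∈ adjoinTheta P.K hK ∅) := by
  refine ⟨PrincipalSeries.supp_eq_iUnion_stem hS,
    PrincipalSeries.exists_subsemigroup_supp_union_K hS, PrincipalSeries.isSemigroupIdeal_K hS, ?_⟩
  have hK : IsSemigroupIdeal P.K := PrincipalSeries.isSemigroupIdeal_K hS
  refine ⟨PrincipalSeries.isMalcevNilpotent_K hS hK,
    fun I hI => PrincipalSeries.subset_K_of_isMalcevNilpotent hS hI, ?_, ?_, ?_⟩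
  · intro C hC
    refine ⟨Set.disjoint_left.2 fun s hs => PrincipalSeries.notMem_K_of_mem_supp hS hC hs, ?_⟩
    obtain ⟨T, hT⟩ := PrincipalSeries.exists_subsemigroup_supp_union_K (P := P) hS C
    let π : S →ₙ* ReesQuotient P.K hK := ⟨ReesQuotient.mk P.K hK, fun _ _ => rfl⟩
    exact ⟨T.map π, by rw [Subsemigroup.coe_map, hT]; rfl⟩
  · refine (Set.eq_univ_of_forall fun q => ?_).symm
    obtain ⟨s, rfl⟩ : ∃ s, ReesQuotient.mk P.K hK s = q := Quotient.mk''_surjective q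
    by_cases hs : s ∈ P.K
    · exact Or.inl ⟨s, Or.inr hs, rfl⟩
    · exact Or.inr (Set.mem_iUnion₂.2 ⟨_, PrincipalSeries.nontrivial_supp_of_notMem_K hS hs,
        s, Or.inl rfl, rfl⟩)
  · intro C D _ _ hCD
    constructor
    · ext q
      constructor
      · rintro ⟨⟨s, hs, rfl⟩, t, ht, hst⟩
        rcases hs with hs | hs
        · rcases (Con.eq _).1 hst with rfl | h
          · rcases ht with ht | ht
            · exact absurd (hs.symm.trans ht) hCD
            · exact ⟨t, Or.inr ht, rfl⟩
          · exact ⟨s, Or.inr h.2, rfl⟩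
        · exact ⟨s, Or.inr hs, rfl⟩
      · rintro ⟨s, hs | hs, rfl⟩
        · exact hs.elim
        · exact ⟨⟨s, Or.inr hs, rfl⟩, s, Or.inr hs, rfl⟩
    · rintro _ ⟨a, ha, rfl⟩ _ ⟨b, hb, rfl⟩
      refine ⟨a * b, Or.inr ?_, rfl⟩
      rcases ha with ha | ha
      · rcases hb with hb | hb
        · by_contra hab
          have h := PrincipalSeries.component_mul_eq hS hab
          exact hCD (ha.symm.trans (h.1.symm.trans (h.2.trans hb)))
        · exact (hK b hb a).1
      · exact (hK a ha b).2
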